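/- Let $M$ be a smooth 3-dimensional manifold (Hausdorff, second countable) with a smooth Riemannian metric $g$, and let $(\phi,\xi,\eta,g)$ be an almost contact metric structure on $M$: $\phi$ is a smooth $(1,1)$-tensor field, $\xi$ a smooth vector field and $\eta$ a smooth 1-form with $\phi^2=-I+\eta\otimes\xi$, $\eta(\xi)=1$ and $g(\phi X,\phi Y)=g(X,Y)-\eta(X)\eta(Y)$. Put $\Phi(X,Y)=g(\phi X,Y)$, and assume that for some $\alpha\in\mathbb R$ the structure is almost $\alpha$-cosymplectic, that is, $d\eta=0$ and $d\Phi=2\alpha\,\eta\wedge\Phi$. Let $\nabla$ be the Levi-Civita connection, $R(X,Y)=\nabla_X\nabla_Y-\nabla_Y\nabla_X-\nabla_{[X,Y]}$ the curvature, $S(Y,Z)=\operatorname{tr}(X\mapsto R(X,Y)Z)$ the Ricci tensor, $h=\tfrac12\mathcal L_\xi\phi$, $l=R(\cdot,\xi)\xi$, and let $\sigma$ be the restriction of $S(\xi,\cdot)$ to $\mathcal D=\ker\eta$. Let $U\subseteq M$ be the set of points where $h\neq0$ and $U'$ the interior of the set of points where $h=0$. Theorem. If $\sigma\equiv0$, then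 $U\cup U'$ is an open dense subset of $M$ and carries a $(\kappa,\mu,\nu)$-structure: there are smooth functions $\kappa,\mu,\nu$ on $U\cup U'$ such that $$R(X,Y)\xi=\eta(Y)(\kappa I+\mu h+\nu\phi h)X-\eta(X)(\kappa I+\mu h+\nu\phi h)Y$$ for all vector fields $X,Y$ on $U\cup U'$. More precisely, there is a smooth function $\lambda$ on $U\cup U'$, positive on $U$ and zero on $U'$, such that around every point of $U$ there is a smooth local orthonormal frame $(e,\phi e,\xi)$ with $he=\lambda e$ and $h\phi e=-\lambda\phi e$, and the functions $\kappa,\mu,\nu$ can be chosen so that $$\kappa=\tfrac12\operatorname{tr}(l)=-(\alpha^2+\lambda^2)\quad\text{on }U\cup U',\qquad \mu=2a,\quad \nu=2\alpha+\frac{\xi(\lambda)}{\lambda}\quad\text{on }U,$$ where $a=g(e,\nabla_\xi\phi e)$ for every such local frame. -/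

import Mathlib

open Bundle
open scoped Manifold ContDiff Topology

noncomputable section

namespace AlmostCosymplectic

section Riemannian

variable {n : ℕ} {M : Type*} [TopologicalSpace M]
  [ChartedSpace (EuclideanSpace ℝ (Fin n)) M] [IsManifold (𝓡 n) ∞ M]

/-- (Not necessarily continuous) vector fields on `M`. -/
abbrev VField (n : ℕ) (M : Type*) [TopologicalSpace M]
    [ChartedSpace (EuclideanSpace ℝ (Fin n)) M] : Type _ :=
  (p : M) → TangentSpace (𝓡 n) p

/-- The vector field `X` is smooth on the set `W`. -/
def SmoothFieldOn (W : Set M) (X : VField n M) : Prop :=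
  ContMDiffOn (𝓡 n) ((𝓡 n).prod 𝓘(ℝ, EuclideanSpace ℝ (Fin n))) ∞
    (fun p => (⟨p, X p⟩ : TangentBundle (𝓡 n) M)) W

/-- The vector field `X` is smooth at (that is, around) the point `p`. -/
def SmoothFieldAt (X : VField n M) (p : M) : Prop :=
  ContMDiffAt (𝓡 n) ((𝓡 n).prod 𝓘(ℝ, EuclideanSpace ℝ (Fin n))) ∞
    (fun q => (⟨q, X q⟩ : TangentBundle (𝓡 n) M)) p

/-- The derivative `X(f)` of a function along a vector field. -/
def dirDeriv (X : VField n M) (f : M → ℝ) (p : M) : ℝ :=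
  mvfderiv (𝓡 n) f p (X p)

/-- The Lie bracket of vector fields. -/
def bracket (X Y : VField n M) : VField n M :=
  VectorField.mlieBracket (𝓡 n) X Y

/-- A vector field that extends the tangent vector `u` at `p` and is smooth around `p`. It is used
only to evaluate tensors (that is, expressions that do not depend on the extension) at `p`. -/
def extendVec {p : M} (u : TangentSpace (𝓡 n) p) : VField n M :=
  FiberBundle.extend (EuclideanSpace ℝ (Fin n)) u

variable [RiemannianBundle (fun p : M => TangentSpace (𝓡 n) p)]

/-- The function `g(X, Y)`. -/
def metric (X Y : VField n M) (p : M) : ℝ := inner ℝ (X p) (Y p)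

instance (p : M) : FiniteDimensional ℝ (TangentSpace (𝓡 n) p) :=
  inferInstanceAs (FiniteDimensional ℝ (EuclideanSpace ℝ (Fin n)))

/-- An orthonormal basis of the tangent space at `p`. -/
def onb (p : M) :
    OrthonormalBasis (Fin (Module.finrank ℝ (TangentSpace (𝓡 n) p))) ℝ
      (TangentSpace (𝓡 n) p) :=
  stdOrthonormalBasis ℝ (TangentSpace (𝓡 n) p)

/-- The right-hand side of the Koszul formula for `2 g(∇_X Y, Z)`. -/
def koszul (X Y Z : VField n M) (p : M) : ℝ :=
  dirDeriv X (metric Y Z) p + dirDeriv Y (metric Z X) p - dirDeriv Z (metric X Y) p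
    + metric (bracket X Y) Z p - metric (bracket Y Z) X p + metric (bracket Z X) Y p

/-- The Levi-Civita connection `∇_X Y`: the vector field with `2 g(∇_X Y, Z) = koszul X Y Z`
for all `Z`, written in an orthonormal basis at every point. -/
def nabla (X Y : VField n M) : VField n M := fun p =>
  ∑ i, ((1 / 2 : ℝ) * koszul X Y (extendVec (onb p i)) p) • onb p i

/-- The curvature `R(X,Y)Z = ∇_X ∇_Y Z - ∇_Y ∇_X Z - ∇_[X,Y] Z`. -/
def curvatureField (X Y Z : VField n M) : VField n M :=
  nabla X (nabla Y Z) - nabla Y (nabla X Z) - nabla (bracket X Y) Z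

/-- The curvature tensor on tangent vectors at `p`. -/
def curvature {p : M} (u v w : TangentSpace (𝓡 n) p) : TangentSpace (𝓡 n) p :=
  curvatureField (extendVec u) (extendVec v) (extendVec w) p

/-- The Ricci tensor `S(v,w) = tr (u ↦ R(u,v)w)`. -/
def ricci {p : M} (v w : TangentSpace (𝓡 n) p) : ℝ :=
  ∑ i, inner ℝ (curvature (onb p i) v w) (onb p i)

end Riemannian

section Structure

variable (n : ℕ) (M : Type*) [TopologicalSpace M]
  [ChartedSpace (EuclideanSpace ℝ (Fin n)) M] [IsManifold (𝓡 n) ∞ M]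
  [RiemannianBundle (fun p : M => TangentSpace (𝓡 n) p)]

/-- An almost contact metric structure `(φ, ξ, η, g)`, where `g` is the given Riemannian metric. -/
structure AlmostContactMetric where
  /-- the field `φ` of endomorphisms of the tangent spaces -/
  phi : (p : M) → TangentSpace (𝓡 n) p →L[ℝ] TangentSpace (𝓡 n) p
  /-- the characteristic vector field `ξ` -/
  xi : VField n M
  /-- the 1-form `η` -/
  eta : (p : M) → TangentSpace (𝓡 n) p →L[ℝ] ℝ
  smooth_phi : ContMDiff (𝓡 n)
    ((𝓡 n).prod 𝓘(ℝ, EuclideanSpace ℝ (Fin n) →L[ℝ] EuclideanSpace ℝ (Fin n))) ∞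
    (fun p => Bundle.TotalSpace.mk' (EuclideanSpace ℝ (Fin n) →L[ℝ] EuclideanSpace ℝ (Fin n))
      (E := fun p : M => TangentSpace (𝓡 n) p →L[ℝ] TangentSpace (𝓡 n) p) p (phi p))
  smooth_xi : SmoothFieldOn Set.univ xi
  smooth_eta : ContMDiff (𝓡 n) ((𝓡 n).prod 𝓘(ℝ, EuclideanSpace ℝ (Fin n) →L[ℝ] ℝ)) ∞
    (fun p => Bundle.TotalSpace.mk' (EuclideanSpace ℝ (Fin n) →L[ℝ] ℝ)
      (E := fun p : M => TangentSpace (𝓡 n) p →L[ℝ] Bundle.Trivial M ℝ p) p (eta p))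
  phi_phi : ∀ (p : M) (u : TangentSpace (𝓡 n) p), phi p (phi p u) = -u + eta p u • xi p
  eta_xi : ∀ p : M, eta p (xi p) = 1
  compatible : ∀ (p : M) (u v : TangentSpace (𝓡 n) p),
    inner ℝ (phi p u) (phi p v) = inner ℝ u v - eta p u * eta p v

variable {n M}

namespace AlmostContactMetric

variable (A : AlmostContactMetric n M)

/-- The vector field `φ X`. -/
def phiF (X : VField n M) : VField n M := fun p => A.phi p (X p)

/-- The function `η(X)`. -/
def etaF (X : VField n M) (p : M) : ℝ := A.eta p (X p)

/-- The fundamental 2-form `Φ(X,Y) = g(φ X, Y)`. -/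
def Phi (X Y : VField n M) (p : M) : ℝ := inner ℝ (A.phi p (X p)) (Y p)

/-- `dη(X,Y) = X(η(Y)) - Y(η(X)) - η([X,Y])`. -/
def dEta (X Y : VField n M) (p : M) : ℝ :=
  dirDeriv X (A.etaF Y) p - dirDeriv Y (A.etaF X) p - A.etaF (bracket X Y) p

/-- `dΦ(X,Y,Z) = X Φ(Y,Z) + Y Φ(Z,X) + Z Φ(X,Y) - Φ([X,Y],Z) - Φ([Y,Z],X) - Φ([Z,X],Y)`. -/
def dPhi (X Y Z : VField n M) (p : M) : ℝ :=
  dirDeriv X (A.Phi Y Z) p + dirDeriv Y (A.Phi Z X) p + dirDeriv Z (A.Phi X Y) p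
    - A.Phi (bracket X Y) Z p - A.Phi (bracket Y Z) X p - A.Phi (bracket Z X) Y p

/-- `(η ∧ Φ)(X,Y,Z) = η(X) Φ(Y,Z) + η(Y) Φ(Z,X) + η(Z) Φ(X,Y)`. -/
def etaWedgePhi (X Y Z : VField n M) (p : M) : ℝ :=
  A.etaF X p * A.Phi Y Z p + A.etaF Y p * A.Phi Z X p + A.etaF Z p * A.Phi X Y p

/-- The structure is almost `α`-cosymplectic: `dη = 0` and `dΦ = 2α η ∧ Φ`. -/
def IsAlmostCosymplectic (α : ℝ) : Prop :=
  (∀ (p : M) (X Y : VField n M), SmoothFieldAt X p → SmoothFieldAt Y p → A.dEta X Y p = 0) ∧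
  (∀ (p : M) (X Y Z : VField n M), SmoothFieldAt X p → SmoothFieldAt Y p → SmoothFieldAt Z p →
    A.dPhi X Y Z p = 2 * α * A.etaWedgePhi X Y Z p)

/-- The tensor field `h = (1/2) L_ξ φ`, that is, `2 h X = [ξ, φ X] - φ [ξ, X]`, on tangent
vectors at `p`. -/
def h {p : M} (u : TangentSpace (𝓡 n) p) : TangentSpace (𝓡 n) p :=
  (1 / 2 : ℝ) • (bracket A.xi (A.phiF (extendVec u)) p - A.phi p (bracket A.xi (extendVec u) p))

/-- The Jacobi operator `l = R(·, ξ)ξ`. -/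
def jacobi {p : M} (u : TangentSpace (𝓡 n) p) : TangentSpace (𝓡 n) p :=
  curvature u (A.xi p) (A.xi p)

/-- The trace `tr(l)` of the Jacobi operator. -/
def traceJacobi (p : M) : ℝ := ∑ i, inner ℝ (A.jacobi (onb p i)) (onb p i)

/-- `σ = S(ξ, ·)` restricted to the distribution `D = ker η` vanishes identically. -/
def SigmaVanishes : Prop :=
  ∀ (p : M) (u : TangentSpace (𝓡 n) p), A.eta p u = 0 → ricci (A.xi p) u = 0

/-- The set `U` of the points at which `h ≠ 0`. -/
def U : Set M := {p | ∃ u : TangentSpace (𝓡 n) p, A.h u ≠ 0}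

/-- The set `U'` of the points that have a neighbourhood on which `h = 0`. -/
def U' : Set M := interior {p | ∀ u : TangentSpace (𝓡 n) p, A.h u = 0}

/-- `(e, φ e, ξ)` is a smooth orthonormal frame on `W` with `h e = lam e`, `h φ e = - lam φ e`. -/
def IsPhiBasis (lam : M → ℝ) (W : Set M) (e : VField n M) : Prop :=
  SmoothFieldOn W e ∧
  ∀ p ∈ W, inner ℝ (e p) (e p) = (1 : ℝ) ∧ A.eta p (e p) = 0 ∧
    A.h (e p) = lam p • e p ∧ A.h (A.phi p (e p)) = -(lam p • A.phi p (e p))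

/-- On `W` the structure is a `(κ, μ, ν)`-structure: `κ`, `μ`, `ν` are smooth functions on `W` and
`R(X,Y)ξ = η(Y)(κ I + μ h + ν φ h)X - η(X)(κ I + μ h + ν φ h)Y` holds on `W`. -/
def IsKappaMuNuOn (W : Set M) (κ μ ν : M → ℝ) : Prop :=
  ContMDiffOn (𝓡 n) 𝓘(ℝ, ℝ) ∞ κ W ∧ ContMDiffOn (𝓡 n) 𝓘(ℝ, ℝ) ∞ μ W ∧
  ContMDiffOn (𝓡 n) 𝓘(ℝ, ℝ) ∞ ν W ∧
  ∀ p ∈ W, ∀ u v : TangentSpace (𝓡 n) p,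
    curvature u v (A.xi p) =
      A.eta p v • (κ p • u + μ p • A.h u + ν p • A.phi p (A.h u))
        - A.eta p u • (κ p • v + μ p • A.h v + ν p • A.phi p (A.h v))

end AlmostContactMetric

end Structure

end AlmostCosymplectic

end

/-!
The statement is local. Around each point `p` there is a smooth unit field `e` in `ker η`, and
`(e, φ e, ξ)` is then a smooth orthonormal frame (`exists_isAdapted`). Since `η` is closed, `∇ξ` is
symmetric and `∇_ξ ξ = 0`; evaluating `dΦ = 2α η ∧ Φ` on the frame gives `div ξ = 2α`
(`IsAdapted.div_xi`). Together these show that `h` vanishes on `ξ` and acts on `ker η` as a symmetric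
trace-free endomorphism, equal to `φ ∘ (∇ξ - α)` (`IsAdapted.h_self`, `IsAdapted.h_phiF`). Hence
`h² = λ²` on `ker η`, where `λ² = tr(h²)/2` is a smooth function on `M`; its square root `λ` is smooth
where it is positive, that is on `U`, and on `U'`, where it vanishes. So `U` is open, and `U ∪ U'` is
dense because `U'` is the interior of the complement of `U`.

Around a point of `U` an explicit `λ`-eigenvector of the symmetric trace-free matrix of `h` can be
normalised to a smooth eigenframe; on `U'` every adapted frame is one
(`IsAlmostCosymplectic.exists_isEigenframe`). In an eigenframe, with `a = g(e, ∇_ξ φ e)`,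
`∇_e ξ = α e - λ φ e`, `∇_{φ e} ξ = α φ e - λ e`, `∇_ξ e = -a φ e` and `∇_ξ φ e = a e`, from which
`R(e, ξ)ξ = (2λa - λ² - α²) e + (ξ(λ) + 2αλ) φ e` and
`R(φ e, ξ)ξ = (ξ(λ) + 2αλ) e + (-2λa - λ² - α²) φ e`
(`IsEigenframe.curvature_self_xi`, `IsEigenframe.curvature_phiF_xi`). In dimension 3 the pair symmetry
of the curvature identifies `R(e, φ e)ξ` with `S(ξ, ·)` on `ker η`, so that `σ = 0` makes it vanish
(`SigmaVanishes.curvature_phi`). As `R(·, ·)ξ` is determined by these three vectors, it has the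
required form with `κ = -(α² + λ²)`, `μ = 2a` and `ν = 2α + ξ(λ)/λ` (`curvature_xi_eq`). The function
`μ` equals `tr(l h)/(2λ²)` on `U`, so it is independent of the eigenframe.

Vector fields are arbitrary sections and tensors are evaluated on chosen extensions of tangent
vectors. The link with calculus on smooth fields is `eq_of_tensorial`: an operation that is local and
linear over functions depends only on the value of the field at the point. It gives the Koszul formula
for `nabla` (`inner_nabla`) and the independence of `curvature` and `h` from the extension
(`curvature_eq`, `h_eq`).
-/

noncomputable section

set_option linter.unusedSectionVars false

namespace AlmostCosymplectic

/-! ### Calculus of functions and vector fields -/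

section Calculus

variable {n : ℕ} {M : Type*} [TopologicalSpace M]
  [ChartedSpace (EuclideanSpace ℝ (Fin n)) M]

/-- The function `f` is smooth at all points near `p`. Since `ContMDiffAt ∞` is not an open
condition, this is stronger than smoothness at `p`. -/
def SmoothFunNear (n : ℕ) {M : Type*} [TopologicalSpace M]
    [ChartedSpace (EuclideanSpace ℝ (Fin n)) M] (f : M → ℝ) (p : M) : Prop :=
  ∀ᶠ q in 𝓝 p, ContMDiffAt (𝓡 n) 𝓘(ℝ, ℝ) ∞ f q

/-- The vector field `X` is smooth at all points near `p`. -/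
def SmoothFieldNear [IsManifold (𝓡 n) ∞ M] (X : VField n M) (p : M) : Prop :=
  ∀ᶠ q in 𝓝 p, SmoothFieldAt X q

variable {f g : M → ℝ} {p : M}

namespace SmoothFunNear

lemma eventually (hf : SmoothFunNear n f p) : ∀ᶠ q in 𝓝 p, SmoothFunNear n f q :=
  eventually_eventually_nhds.2 hf

lemma mdiff (hf : SmoothFunNear n f p) : MDifferentiableAt (𝓡 n) 𝓘(ℝ, ℝ) f p :=
  hf.self_of_nhds.mdifferentiableAt (by simp)

lemma congr (hf : SmoothFunNear n f p) (h : g =ᶠ[𝓝 p] f) : SmoothFunNear n g p := by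
  filter_upwards [hf, h.eventuallyEq_nhds] with q hq hq' using hq.congr_of_eventuallyEq hq'

lemma const (c : ℝ) : SmoothFunNear n (fun _ : M => c) p :=
  Filter.Eventually.of_forall fun _ => contMDiffAt_const

lemma add (hf : SmoothFunNear n f p) (hg : SmoothFunNear n g p) : SmoothFunNear n (f + g) p := by
  filter_upwards [hf, hg] with q h1 h2 using h1.add h2

lemma neg (hf : SmoothFunNear n f p) : SmoothFunNear n (-f) p := by
  filter_upwards [hf] with q h1 using h1.neg

lemma sub (hf : SmoothFunNear n f p) (hg : SmoothFunNear n g p) : SmoothFunNear n (f - g) p := by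
  filter_upwards [hf, hg] with q h1 h2 using h1.sub h2

lemma mul (hf : SmoothFunNear n f p) (hg : SmoothFunNear n g p) : SmoothFunNear n (f * g) p := by
  filter_upwards [hf, hg] with q h1 h2 using h1.mul h2

lemma inv (hf : SmoothFunNear n f p) (h0 : f p ≠ 0) : SmoothFunNear n (fun q => (f q)⁻¹) p := by
  have : ∀ᶠ q in 𝓝 p, f q ≠ 0 := hf.self_of_nhds.continuousAt.eventually_ne h0
  filter_upwards [hf, this] with q h1 h2
  exact ((contDiffAt_inv ℝ h2).contMDiffAt).comp q h1

lemma sqrt (hf : SmoothFunNear n f p) (h0 : f p ≠ 0) :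
    SmoothFunNear n (fun q => Real.sqrt (f q)) p := by
  have : ∀ᶠ q in 𝓝 p, f q ≠ 0 := hf.self_of_nhds.continuousAt.eventually_ne h0
  filter_upwards [hf, this] with q h1 h2
  exact ((Real.contDiffAt_sqrt h2).contMDiffAt).comp q h1

end SmoothFunNear

variable [IsManifold (𝓡 n) ∞ M] {X Y Z X' Y' : VField n M}

-- The tangent bundle of a `C^(m+1)` manifold is `C^m`, and the results on Lie brackets ask for
-- `C^2` and `C^3` manifolds; a smooth manifold qualifies, as `∞ + 1 = ∞`.
scoped instance : IsManifold (𝓡 n) (∞ + 1) M := inferInstanceAs (IsManifold (𝓡 n) ∞ M)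
scoped instance : IsManifold (𝓡 n) (minSmoothness ℝ 2) M := .of_le (n := ∞) (by simp; norm_cast)
scoped instance : IsManifold (𝓡 n) (minSmoothness ℝ 3) M := .of_le (n := ∞) (by simp; norm_cast)

namespace SmoothFieldNear

lemma eventually (hX : SmoothFieldNear X p) : ∀ᶠ q in 𝓝 p, SmoothFieldNear X q :=
  eventually_eventually_nhds.2 hX

lemma smoothAt (hX : SmoothFieldNear X p) : SmoothFieldAt X p := hX.self_of_nhds

lemma mdiff (hX : SmoothFieldNear X p) :
    MDifferentiableAt (𝓡 n) ((𝓡 n).prod 𝓘(ℝ, EuclideanSpace ℝ (Fin n)))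
      (fun q => (⟨q, X q⟩ : TangentBundle (𝓡 n) M)) p :=
  ContMDiffAt.mdifferentiableAt hX.smoothAt (by simp)

lemma congr (hX : SmoothFieldNear X p) (h : Y =ᶠ[𝓝 p] X) : SmoothFieldNear Y p := by
  filter_upwards [hX, h.eventuallyEq_nhds] with q hq hq'
  refine ContMDiffAt.congr_of_eventuallyEq hq ?_
  filter_upwards [hq'] with r hr
  rw [hr]

lemma add (hX : SmoothFieldNear X p) (hY : SmoothFieldNear Y p) : SmoothFieldNear (X + Y) p := by
  filter_upwards [hX, hY] with q h1 h2 using ContMDiffAt.add_section h1 h2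

lemma sub (hX : SmoothFieldNear X p) (hY : SmoothFieldNear Y p) : SmoothFieldNear (X - Y) p := by
  filter_upwards [hX, hY] with q h1 h2 using ContMDiffAt.sub_section h1 h2

lemma neg (hX : SmoothFieldNear X p) : SmoothFieldNear (-X) p := by
  filter_upwards [hX] with q h1 using ContMDiffAt.neg_section h1

lemma smul (hf : SmoothFunNear n f p) (hX : SmoothFieldNear X p) : SmoothFieldNear (f • X) p := by
  filter_upwards [hf, hX] with q h1 h2 using ContMDiffAt.smul_section h1 h2

lemma zero : SmoothFieldNear (0 : VField n M) p :=
  Filter.Eventually.of_forall fun q => contMDiff_zeroSection ℝ (TangentSpace (𝓡 n) : M → Type _) q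

lemma sum {ι : Type*} {s : Finset ι} {X : ι → VField n M}
    (hX : ∀ i ∈ s, SmoothFieldNear (X i) p) : SmoothFieldNear (fun q => ∑ i ∈ s, X i q) p := by
  have := (s.eventually_all).2 hX
  filter_upwards [this] with q hq
  exact ContMDiffAt.sum_section hq

lemma extendVec (u : TangentSpace (𝓡 n) p) : SmoothFieldNear (extendVec u) p := by
  obtain ⟨s, hs, h⟩ := FiberBundle.exists_contMDiffOn_extend (k := ∞) (𝓡 n)
    (EuclideanSpace ℝ (Fin n)) u
  filter_upwards [eventually_mem_nhds_iff.2 hs] with q hq using h.contMDiffAt hq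

lemma bracket (hX : SmoothFieldNear X p) (hY : SmoothFieldNear Y p) :
    SmoothFieldNear (bracket X Y) p := by
  filter_upwards [hX, hY] with q h1 h2
  exact ContMDiffAt.mlieBracket_vectorField (n := ⊤) (m := ⊤) h1 h2 (by simp)

end SmoothFieldNear

@[simp] lemma extendVec_self (u : TangentSpace (𝓡 n) p) : extendVec u p = u :=
  FiberBundle.extend_apply_self _ u

/-- The differential of `f` is smooth as a section of the cotangent bundle, so pairing it with a
smooth field gives a smooth function. -/
lemma SmoothFunNear.dirDeriv (hX : SmoothFieldNear X p) (hf : SmoothFunNear n f p) :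
    SmoothFunNear n (dirDeriv X f) p := by
  filter_upwards [hX, hf] with q h1 h2
  have h3 := ContMDiffAt.mfderiv_const (m := ∞) h2 (by simp)
  have := ContMDiffAt.clm_apply_of_inCoordinates (b₁ := id) (b₂ := f) h3 h1 h2
  rw [contMDiffAt_totalSpace] at this
  simpa using! this.2

lemma dirDeriv_add (hf : SmoothFunNear n f p) (hg : SmoothFunNear n g p) :
    dirDeriv X (f + g) p = dirDeriv X f p + dirDeriv X g p := by
  simp [dirDeriv, mvfderiv_add hf.mdiff hg.mdiff]

lemma dirDeriv_neg : dirDeriv X (-f) p = - dirDeriv X f p := by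
  simp [dirDeriv, mvfderiv_neg]

lemma dirDeriv_mul (hf : SmoothFunNear n f p) (hg : SmoothFunNear n g p) :
    dirDeriv X (f * g) p = f p * dirDeriv X g p + g p * dirDeriv X f p := by
  simp [dirDeriv, mvfderiv_mul hf.mdiff hg.mdiff]

@[simp] lemma dirDeriv_const (c : ℝ) : dirDeriv X (fun _ => c) p = 0 := by
  simp [dirDeriv, mvfderiv_const]

lemma dirDeriv_congr (h : f =ᶠ[𝓝 p] g) : dirDeriv X f p = dirDeriv X g p := by
  have h1 : mfderiv (𝓡 n) 𝓘(ℝ, ℝ) f p = mfderiv (𝓡 n) 𝓘(ℝ, ℝ) g p := h.mfderiv_eq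
  change (mfderiv (𝓡 n) 𝓘(ℝ, ℝ) f p (X p) : ℝ) = (mfderiv (𝓡 n) 𝓘(ℝ, ℝ) g p (X p) : ℝ)
  rw [h1]
  rfl

lemma dirDeriv_field_congr (h : X p = Y p) : dirDeriv X f p = dirDeriv Y f p := by
  simp [dirDeriv, h]

lemma dirDeriv_field_add : dirDeriv (X + Y) f p = dirDeriv X f p + dirDeriv Y f p := by
  simp [dirDeriv]

lemma dirDeriv_field_smul : dirDeriv (g • X) f p = g p * dirDeriv X f p := by
  simp [dirDeriv]

lemma bracket_swap : bracket X Y = - bracket Y X := VectorField.mlieBracket_swap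

lemma bracket_add_left (hX : SmoothFieldNear X p) (hY : SmoothFieldNear Y p) :
    bracket (X + Y) Z p = bracket X Z p + bracket Y Z p :=
  VectorField.mlieBracket_add_left hX.mdiff hY.mdiff

lemma bracket_add_right (hX : SmoothFieldNear X p) (hY : SmoothFieldNear Y p) :
    bracket Z (X + Y) p = bracket Z X p + bracket Z Y p :=
  VectorField.mlieBracket_add_right hX.mdiff hY.mdiff

lemma bracket_smul_right (hf : SmoothFunNear n f p) (hY : SmoothFieldNear Y p) :
    bracket X (f • Y) p = dirDeriv X f p • Y p + f p • bracket X Y p :=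
  VectorField.mlieBracket_smul_right hf.mdiff hY.mdiff

lemma bracket_smul_left (hf : SmoothFunNear n f p) (hX : SmoothFieldNear X p) :
    bracket (f • X) Y p = - dirDeriv Y f p • X p + f p • bracket X Y p :=
  VectorField.mlieBracket_smul_left hf.mdiff hX.mdiff

lemma bracket_congr (hX : X =ᶠ[𝓝 p] X') (hY : Y =ᶠ[𝓝 p] Y') : bracket X Y p = bracket X' Y' p :=
  hX.mlieBracket_vectorField_eq hY

lemma bracket_eventually_congr (hX : X =ᶠ[𝓝 p] X') (hY : Y =ᶠ[𝓝 p] Y') :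
    bracket X Y =ᶠ[𝓝 p] bracket X' Y' := hX.mlieBracket_vectorField hY

/-- The Jacobi identity in Leibniz form. -/
lemma jacobi_identity (hX : SmoothFieldNear X p) (hY : SmoothFieldNear Y p)
    (hZ : SmoothFieldNear Z p) :
    bracket X (bracket Y Z) p = bracket (bracket X Y) Z p + bracket Y (bracket X Z) p := by
  have h2 : minSmoothness ℝ 2 ≤ (∞ : WithTop ℕ∞) := by simp; norm_cast
  exact VectorField.leibniz_identity_mlieBracket_apply (ContMDiffAt.of_le hX.smoothAt h2)
    (ContMDiffAt.of_le hY.smoothAt h2) (ContMDiffAt.of_le hZ.smoothAt h2)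

/-- The Lie bracket acts on functions as the commutator of derivations. Comparing coefficients of
`Z` in the Jacobi identity for `X`, `Y` and `f Z` reduces this to the Leibniz rules. -/
lemma dirDeriv_bracket (hX : SmoothFieldNear X p) (hY : SmoothFieldNear Y p)
    (hf : SmoothFunNear n f p) :
    dirDeriv (bracket X Y) f p = dirDeriv X (dirDeriv Y f) p - dirDeriv Y (dirDeriv X f) p := by
  -- in dimension 0 there is no nonvanishing `Z`, but every field is zero
  by_cases h0 : ∀ u : TangentSpace (𝓡 n) p, u = 0
  · simp [dirDeriv, h0 (X p), h0 (Y p), h0 (bracket X Y p)]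
  push Not at h0
  obtain ⟨u, hu⟩ := h0
  set Z := extendVec u
  have hZ : SmoothFieldNear Z p := .extendVec u
  have key : ∀ {X Y : VField n M}, SmoothFieldNear X p → SmoothFieldNear Y p →
      bracket X (bracket Y (f • Z)) p = dirDeriv X (dirDeriv Y f) p • Z p
        + dirDeriv Y f p • bracket X Z p + dirDeriv X f p • bracket Y Z p
        + f p • bracket X (bracket Y Z) p := by
    intro X Y hX hY
    have h1 : bracket Y (f • Z) =ᶠ[𝓝 p] dirDeriv Y f • Z + f • bracket Y Z := by
      filter_upwards [hf.eventually, hZ.eventually] with q h1 h2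
      exact bracket_smul_right h1 h2
    rw [bracket_congr (Filter.EventuallyEq.refl _ X) h1,
      bracket_add_right (.smul (.dirDeriv hY hf) hZ) (.smul hf (.bracket hY hZ)),
      bracket_smul_right (.dirDeriv hY hf) hZ, bracket_smul_right hf (.bracket hY hZ)]
    abel
  have J := jacobi_identity hX hY (.smul hf hZ)
  rw [key hX hY, key hY hX, bracket_smul_right hf hZ, jacobi_identity hX hY hZ] at J
  have h2 : (dirDeriv (bracket X Y) f p - (dirDeriv X (dirDeriv Y f) p
      - dirDeriv Y (dirDeriv X f) p)) • Z p = 0 := by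
    rw [sub_smul, sub_smul, sub_eq_zero]
    have := sub_eq_zero.2 J
    rw [← sub_eq_zero, ← neg_eq_zero, ← this]
    module
  have hZ0 : Z p ≠ 0 := by simpa [Z] using hu
  exact sub_eq_zero.1 ((smul_eq_zero.1 h2).resolve_right hZ0)

end Calculus

/-! ### Orthonormal frames and tensoriality -/

section Frames

variable {n : ℕ} {M : Type*} [TopologicalSpace M]
  [ChartedSpace (EuclideanSpace ℝ (Fin n)) M] [IsManifold (𝓡 n) ∞ M]
  [RiemannianBundle (fun p : M => TangentSpace (𝓡 n) p)]
  {X Y Z X' Y' : VField n M} {f : M → ℝ} {p : M}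

lemma metric_comm : metric X Y = metric Y X := by
  ext q; exact real_inner_comm _ _

lemma metric_add_left : metric (X + Y) Z = metric X Z + metric Y Z := by
  ext q; simp [metric, inner_add_left]

lemma metric_add_right : metric X (Y + Z) = metric X Y + metric X Z := by
  ext q; simp [metric, inner_add_right]

lemma metric_smul_left : metric (f • X) Y = f * metric X Y := by
  ext q; simp [metric, inner_smul_left]

lemma metric_smul_right : metric X (f • Y) = f * metric X Y := by
  ext q; simp [metric, inner_smul_right]

/-- A family of `n` vector fields that are smooth and orthonormal around `p`. -/
structure IsOrthonormalFrame (E : Fin n → VField n M) (p : M) : Prop where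
  smooth : ∀ i, SmoothFieldNear (E i) p
  orthonormal : ∀ᶠ q in 𝓝 p, Orthonormal ℝ (fun i => E i q)

lemma finrank_tangentSpace (p : M) : Module.finrank ℝ (TangentSpace (𝓡 n) p) = n :=
  finrank_euclideanSpace_fin

lemma sum_inner_smul_of_orthonormal {q : M} {E : Fin n → TangentSpace (𝓡 n) q}
    (hE : Orthonormal ℝ E) (v : TangentSpace (𝓡 n) q) : ∑ i, inner ℝ (E i) v • E i = v := by
  have hs : ⊤ ≤ Submodule.span ℝ (Set.range E) := by
    rw [hE.linearIndependent.span_eq_top_of_card_eq_finrank']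
    simp [finrank_tangentSpace]
  simpa using (OrthonormalBasis.mk hE hs).sum_repr' v

/-- Two tangent vectors with the same scalar products with all vector fields agree. -/
lemma ext_metric {u v : TangentSpace (𝓡 n) p}
    (h : ∀ Z : VField n M, SmoothFieldNear Z p → inner ℝ u (Z p) = inner ℝ v (Z p)) : u = v := by
  refine ext_inner_right ℝ fun w => ?_
  simpa using h (extendVec w) (.extendVec w)

variable [IsContMDiffRiemannianBundle (𝓡 n) ∞ (EuclideanSpace ℝ (Fin n))
      (fun p : M => TangentSpace (𝓡 n) p)]

lemma SmoothFunNear.metric (hX : SmoothFieldNear X p) (hY : SmoothFieldNear Y p) :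
    SmoothFunNear n (metric X Y) p := by
  filter_upwards [hX, hY] with q h1 h2
  exact ContMDiffAt.inner_bundle h1 h2

/-- The Gram–Schmidt process turns the frame of a trivialization of the tangent bundle into a smooth
orthonormal one. -/
lemma exists_orthonormalFrame (p : M) : ∃ E : Fin n → VField n M, IsOrthonormalFrame E p := by
  let t := trivializationAt (EuclideanSpace ℝ (Fin n)) (TangentSpace (𝓡 n) : M → Type _) p
  let b := (EuclideanSpace.basisFun (Fin n) ℝ).toBasis
  let s : Fin n → VField n M := t.localFrame b
  have hp : p ∈ t.baseSet := FiberBundle.mem_baseSet_trivializationAt' p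
  have hs := t.isLocalFrameOn_localFrame_baseSet (𝓡 n) ∞ b
  have hb : ∀ᶠ q in 𝓝 p, q ∈ t.baseSet := t.open_baseSet.mem_nhds hp
  have hsm : ∀ i, SmoothFieldNear (s i) p := fun i => by
    filter_upwards [hb] with q hq
    exact hs.contMDiffAt t.open_baseSet hq i
  let G : Fin n → VField n M := fun i q => InnerProductSpace.gramSchmidt ℝ (fun j => s j q) i
  have hli : ∀ᶠ q in 𝓝 p, LinearIndependent ℝ (fun j => s j q) := by
    filter_upwards [hb] with q hq using hs.linearIndependent hq
  -- the Gram–Schmidt recursion only uses scalar products and inverses of nonzero functions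
  have hG : ∀ i, SmoothFieldNear (G i) p := by
    intro i
    induction i using WellFoundedLT.induction with
    | ind i ih =>
      have h1 : G i = fun q => s i q - ∑ j ∈ Finset.Iio i,
          (metric (G j) (s i) q * (metric (G j) (G j) q)⁻¹) • G j q := by
        ext1 q
        have := InnerProductSpace.gramSchmidt_def'' ℝ (fun j => s j q) i
        simp only [metric, G, real_inner_self_eq_norm_sq]
        exact eq_sub_of_add_eq this.symm
      rw [h1]
      refine .sub (hsm i) (.sum fun j hj => ?_)
      have hj := ih j (Finset.mem_Iio.1 hj)
      refine .smul (f := metric (G j) (s i) * fun q => (metric (G j) (G j) q)⁻¹)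
        (.mul (.metric hj (hsm i)) (.inv (.metric hj hj) ?_)) hj
      simpa [metric, G] using InnerProductSpace.gramSchmidt_ne_zero j hli.self_of_nhds
  refine ⟨fun i => (fun q => (Real.sqrt (metric (G i) (G i) q))⁻¹) • G i, fun i => ?_, ?_⟩
  · have h0 : metric (G i) (G i) p ≠ 0 := by
      simpa [metric, G] using InnerProductSpace.gramSchmidt_ne_zero i hli.self_of_nhds
    refine .smul (.inv (.sqrt (.metric (hG i) (hG i)) h0) ?_) (hG i)
    exact (Real.sqrt_pos.2 (lt_of_le_of_ne real_inner_self_nonneg h0.symm)).ne'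
  · filter_upwards [hli] with q hq
    have := InnerProductSpace.gramSchmidtNormed_orthonormal (𝕜 := ℝ) hq
    convert this using 2 with i
    simp [InnerProductSpace.gramSchmidtNormed, metric, G]

/-- An operation on vector fields that is local and linear over functions depends only on the value
of the field at the point. -/
lemma eq_of_tensorial {A : Type*} [AddCommGroup A] [Module ℝ A] {T : VField n M → A}
    (hloc : ∀ {X Y}, SmoothFieldNear X p → SmoothFieldNear Y p → X =ᶠ[𝓝 p] Y → T X = T Y)
    (hadd : ∀ {X Y}, SmoothFieldNear X p → SmoothFieldNear Y p → T (X + Y) = T X + T Y)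
    (hsmul : ∀ {f X}, SmoothFunNear n f p → SmoothFieldNear X p → T (f • X) = f p • T X)
    (hX : SmoothFieldNear X p) (hY : SmoothFieldNear Y p) (h : X p = Y p) : T X = T Y := by
  obtain ⟨E, hE⟩ := exists_orthonormalFrame (n := n) p
  have h0 : T 0 = 0 := by
    have := hsmul (f := fun _ => 0) (.const 0) (.zero (n := n) (M := M))
    simpa using this
  have key : ∀ {X}, SmoothFieldNear X p → T X = ∑ i, metric (E i) X p • T (E i) := by
    intro X hX
    have hsm : ∀ i, SmoothFieldNear (metric (E i) X • E i) p := fun i =>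
      .smul (.metric (hE.smooth i) hX) (hE.smooth i)
    have h1 : X =ᶠ[𝓝 p] ∑ i, metric (E i) X • E i := by
      filter_upwards [hE.orthonormal] with q hq
      exact (sum_inner_smul_of_orthonormal hq (X q)).symm.trans (Finset.sum_apply q
        Finset.univ (fun i => metric (E i) X • E i)).symm
    have h2 : ∀ s : Finset (Fin n), SmoothFieldNear (∑ i ∈ s, metric (E i) X • E i) p ∧
        T (∑ i ∈ s, metric (E i) X • E i) = ∑ i ∈ s, metric (E i) X p • T (E i) := by
      classical
      intro s
      induction s using Finset.induction_on with
      | empty => simpa [h0] using SmoothFieldNear.zero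
      | insert i s hi ih =>
        rw [Finset.sum_insert hi, Finset.sum_insert hi, hadd (hsm i) ih.1, ih.2,
          hsmul (.metric (hE.smooth i) hX) (hE.smooth i)]
        exact ⟨.add (hsm i) ih.1, rfl⟩
    rw [hloc hX (h2 Finset.univ).1 h1, (h2 Finset.univ).2]
  rw [key hX, key hY]
  simp [metric, h]

end Frames

/-! ### The Levi-Civita connection -/

section LeviCivita

variable {n : ℕ} {M : Type*} [TopologicalSpace M]
  [ChartedSpace (EuclideanSpace ℝ (Fin n)) M] [IsManifold (𝓡 n) ∞ M]
  [RiemannianBundle (fun p : M => TangentSpace (𝓡 n) p)]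
  [IsContMDiffRiemannianBundle (𝓡 n) ∞ (EuclideanSpace ℝ (Fin n))
      (fun p : M => TangentSpace (𝓡 n) p)]
  {X Y Z X' Y' Z' : VField n M} {f : M → ℝ} {p : M}

lemma metric_congr (hX : X =ᶠ[𝓝 p] X') (hY : Y =ᶠ[𝓝 p] Y') :
    metric X Y =ᶠ[𝓝 p] metric X' Y' := by
  filter_upwards [hX, hY] with q h1 h2
  simp [metric, h1, h2]

lemma koszul_congr (hX : X =ᶠ[𝓝 p] X') (hY : Y =ᶠ[𝓝 p] Y') (hZ : Z =ᶠ[𝓝 p] Z') :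
    koszul X Y Z p = koszul X' Y' Z' p := by
  simp only [koszul, dirDeriv_congr (metric_congr hY hZ), dirDeriv_congr (metric_congr hZ hX),
    dirDeriv_congr (metric_congr hX hY), dirDeriv_field_congr hX.self_of_nhds,
    dirDeriv_field_congr hY.self_of_nhds, dirDeriv_field_congr hZ.self_of_nhds]
  simp only [metric, bracket_congr hX hY, bracket_congr hY hZ, bracket_congr hZ hX,
    hX.self_of_nhds, hY.self_of_nhds, hZ.self_of_nhds]

lemma koszul_add_right (hX : SmoothFieldNear X p) (hY : SmoothFieldNear Y p)
    (hZ : SmoothFieldNear Z p) (hZ' : SmoothFieldNear Z' p) :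
    koszul X Y (Z + Z') p = koszul X Y Z p + koszul X Y Z' p := by
  simp only [koszul, metric_add_left, metric_add_right, dirDeriv_field_add,
    dirDeriv_add (SmoothFunNear.metric hY hZ) (SmoothFunNear.metric hY hZ'),
    dirDeriv_add (SmoothFunNear.metric hZ hX) (SmoothFunNear.metric hZ' hX), Pi.add_apply]
  simp only [metric, bracket_add_right hZ hZ', bracket_add_left hZ hZ', inner_add_left]
  ring

lemma koszul_smul_right (hX : SmoothFieldNear X p) (hY : SmoothFieldNear Y p)
    (hf : SmoothFunNear n f p) (hZ : SmoothFieldNear Z p) :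
    koszul X Y (f • Z) p = f p * koszul X Y Z p := by
  simp only [koszul, metric_smul_left, metric_smul_right, dirDeriv_field_smul,
    dirDeriv_mul hf (SmoothFunNear.metric hY hZ),
    dirDeriv_mul hf (SmoothFunNear.metric hZ hX), Pi.mul_apply]
  simp only [metric, bracket_smul_right hf hZ, bracket_smul_left hf hZ, inner_add_left,
    real_inner_smul_left, real_inner_comm (Y p) (Z p)]
  ring

lemma koszul_add_middle (hX : SmoothFieldNear X p) (hY : SmoothFieldNear Y p)
    (hY' : SmoothFieldNear Y' p) (hZ : SmoothFieldNear Z p) :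
    koszul X (Y + Y') Z p = koszul X Y Z p + koszul X Y' Z p := by
  simp only [koszul, metric_add_left, metric_add_right, dirDeriv_field_add,
    dirDeriv_add (SmoothFunNear.metric hY hZ) (SmoothFunNear.metric hY' hZ),
    dirDeriv_add (SmoothFunNear.metric hX hY) (SmoothFunNear.metric hX hY'), Pi.add_apply]
  simp only [metric, bracket_add_right hY hY', bracket_add_left hY hY', inner_add_left]
  ring

/-- In contrast to the other two slots, a derivative of the factor survives here; it becomes the
Leibniz rule for `nabla`. -/
lemma koszul_smul_middle (hX : SmoothFieldNear X p) (hf : SmoothFunNear n f p)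
    (hY : SmoothFieldNear Y p) (hZ : SmoothFieldNear Z p) :
    koszul X (f • Y) Z p = f p * koszul X Y Z p + 2 * (dirDeriv X f p * metric Y Z p) := by
  simp only [koszul, metric_smul_left, metric_smul_right, dirDeriv_field_smul,
    dirDeriv_mul hf (SmoothFunNear.metric hY hZ),
    dirDeriv_mul hf (SmoothFunNear.metric hX hY), Pi.mul_apply]
  simp only [metric, bracket_smul_right hf hY, bracket_smul_left hf hY, inner_add_left,
    real_inner_smul_left, real_inner_comm (X p) (Y p)]
  ring

lemma koszul_add_left (hX : SmoothFieldNear X p) (hX' : SmoothFieldNear X' p)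
    (hY : SmoothFieldNear Y p) (hZ : SmoothFieldNear Z p) :
    koszul (X + X') Y Z p = koszul X Y Z p + koszul X' Y Z p := by
  simp only [koszul, metric_add_left, metric_add_right, dirDeriv_field_add,
    dirDeriv_add (SmoothFunNear.metric hX hY) (SmoothFunNear.metric hX' hY),
    dirDeriv_add (SmoothFunNear.metric hZ hX) (SmoothFunNear.metric hZ hX'), Pi.add_apply]
  simp only [metric, bracket_add_right hX hX', bracket_add_left hX hX', inner_add_left]
  ring

lemma koszul_smul_left (hf : SmoothFunNear n f p) (hX : SmoothFieldNear X p)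
    (hY : SmoothFieldNear Y p) (hZ : SmoothFieldNear Z p) :
    koszul (f • X) Y Z p = f p * koszul X Y Z p := by
  simp only [koszul, metric_smul_left, metric_smul_right, dirDeriv_field_smul,
    dirDeriv_mul hf (SmoothFunNear.metric hZ hX),
    dirDeriv_mul hf (SmoothFunNear.metric hX hY), Pi.mul_apply]
  simp only [metric, bracket_smul_right hf hX, bracket_smul_left hf hX, inner_add_left,
    real_inner_smul_left, real_inner_comm (Z p) (X p)]
  ring

lemma bracket_apply_swap (q : M) : bracket X Y q = - bracket Y X q := by
  rw [bracket_swap]; rfl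

/-- The part of the Koszul expression that is skew in `X` and `Y` accounts for the torsion. -/
lemma koszul_sub_koszul_swap :
    koszul X Y Z p - koszul Y X Z p = 2 * metric (bracket X Y) Z p := by
  simp only [koszul, metric_comm (X := Z), metric_comm (X := Y) (Y := X)]
  simp only [metric, bracket_apply_swap (X := Y) (Y := X), bracket_apply_swap (X := Z),
    inner_neg_left, real_inner_comm]
  ring

/-- The part of the Koszul expression that is symmetric in `Y` and `Z` accounts for the metric. -/
lemma koszul_add_koszul_swap :
    koszul X Y Z p + koszul X Z Y p = 2 * dirDeriv X (metric Y Z) p := by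
  simp only [koszul, metric_comm (X := Z), metric_comm (X := Y) (Y := X)]
  simp only [metric, bracket_apply_swap (X := Y) (Y := X), bracket_apply_swap (X := Z),
    inner_neg_left, real_inner_comm]
  ring

/-- The Koszul formula, which determines `nabla`. -/
lemma inner_nabla (hX : SmoothFieldNear X p) (hY : SmoothFieldNear Y p)
    (hZ : SmoothFieldNear Z p) :
    inner ℝ (nabla X Y p) (Z p) = (1 / 2 : ℝ) * koszul X Y Z p := by
  have key : ∀ s : Finset (Fin (Module.finrank ℝ (TangentSpace (𝓡 n) p))),
      SmoothFieldNear
        (∑ i ∈ s, (fun _ => inner ℝ (onb p i) (Z p) : M → ℝ) • extendVec (onb p i)) p ∧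
      koszul X Y (∑ i ∈ s, (fun _ => inner ℝ (onb p i) (Z p) : M → ℝ) • extendVec (onb p i)) p =
        ∑ i ∈ s, inner ℝ (onb p i) (Z p) * koszul X Y (extendVec (onb p i)) p := by
    classical
    intro s
    induction s using Finset.induction_on with
    | empty =>
      have := koszul_smul_right hX hY (.const 0) (.zero (n := n) (M := M))
      simpa using ⟨SmoothFieldNear.zero, by simpa using this⟩
    | insert i s hi ih =>
      have h1 : SmoothFieldNear
          ((fun _ => inner ℝ (onb p i) (Z p) : M → ℝ) • extendVec (onb p i)) p :=
        .smul (.const _) (.extendVec _)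
      rw [Finset.sum_insert hi, Finset.sum_insert hi, koszul_add_right hX hY h1 ih.1, ih.2,
        koszul_smul_right hX hY (.const _) (.extendVec _)]
      exact ⟨.add h1 ih.1, rfl⟩
  -- `Z` may be replaced by the combination of the extended basis vectors with its coordinates at `p`
  have h2 := eq_of_tensorial (T := fun Z => koszul X Y Z p)
    (fun _ _ h => koszul_congr (.refl _ X) (.refl _ Y) h)
    (fun h h' => koszul_add_right hX hY h h') (fun h h' => koszul_smul_right hX hY h h')
    hZ (key Finset.univ).1 (by
      refine ((onb p).sum_repr' (Z p)).symm.trans (Eq.trans ?_ (Finset.sum_apply p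
        Finset.univ
        (fun i => (fun _ => inner ℝ (onb p i) (Z p) : M → ℝ) • extendVec (onb p i))).symm)
      simp)
  rw [show koszul X Y Z p = _ from h2, (key _).2, nabla, sum_inner, Finset.mul_sum]
  refine Finset.sum_congr rfl fun i _ => ?_
  rw [real_inner_smul_left]
  ring

lemma metric_nabla (hX : SmoothFieldNear X p) (hY : SmoothFieldNear Y p)
    (hZ : SmoothFieldNear Z p) : metric (nabla X Y) Z p = (1 / 2 : ℝ) * koszul X Y Z p :=
  inner_nabla hX hY hZ

lemma nabla_congr (hX : X =ᶠ[𝓝 p] X') (hY : Y =ᶠ[𝓝 p] Y') : nabla X Y p = nabla X' Y' p := by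
  refine Finset.sum_congr rfl fun i _ => ?_
  rw [koszul_congr hX hY (.refl _ (extendVec (onb p i)))]

lemma nabla_eventually_congr (hX : X =ᶠ[𝓝 p] X') (hY : Y =ᶠ[𝓝 p] Y') :
    nabla X Y =ᶠ[𝓝 p] nabla X' Y' := by
  filter_upwards [hX.eventuallyEq_nhds, hY.eventuallyEq_nhds] with q h1 h2 using nabla_congr h1 h2

lemma nabla_add_right (hX : SmoothFieldNear X p) (hY : SmoothFieldNear Y p)
    (hY' : SmoothFieldNear Y' p) : nabla X (Y + Y') p = nabla X Y p + nabla X Y' p := by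
  refine ext_metric fun Z hZ => ?_
  rw [inner_add_left, inner_nabla hX (hY.add hY') hZ, inner_nabla hX hY hZ, inner_nabla hX hY' hZ,
    koszul_add_middle hX hY hY' hZ]
  ring

lemma nabla_smul_right (hX : SmoothFieldNear X p) (hf : SmoothFunNear n f p)
    (hY : SmoothFieldNear Y p) :
    nabla X (f • Y) p = dirDeriv X f p • Y p + f p • nabla X Y p := by
  refine ext_metric fun Z hZ => ?_
  rw [inner_add_left, real_inner_smul_left, real_inner_smul_left, inner_nabla hX (.smul hf hY) hZ,
    inner_nabla hX hY hZ, koszul_smul_middle hX hf hY hZ, metric]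
  ring

lemma nabla_add_left (hX : SmoothFieldNear X p) (hX' : SmoothFieldNear X' p)
    (hY : SmoothFieldNear Y p) : nabla (X + X') Y p = nabla X Y p + nabla X' Y p := by
  refine ext_metric fun Z hZ => ?_
  rw [inner_add_left, inner_nabla (hX.add hX') hY hZ, inner_nabla hX hY hZ, inner_nabla hX' hY hZ,
    koszul_add_left hX hX' hY hZ]
  ring

lemma nabla_smul_left (hf : SmoothFunNear n f p) (hX : SmoothFieldNear X p)
    (hY : SmoothFieldNear Y p) : nabla (f • X) Y p = f p • nabla X Y p := by
  refine ext_metric fun Z hZ => ?_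
  rw [real_inner_smul_left, inner_nabla (.smul hf hX) hY hZ,
    inner_nabla hX hY hZ, koszul_smul_left hf hX hY hZ]
  ring

/-- The connection is tensorial in the direction of differentiation. -/
lemma nabla_congr_left (hX : SmoothFieldNear X p) (hX' : SmoothFieldNear X' p)
    (hY : SmoothFieldNear Y p) (h : X p = X' p) : nabla X Y p = nabla X' Y p :=
  eq_of_tensorial (T := fun X => nabla X Y p) (fun _ _ h => nabla_congr h (.refl _ Y))
    (fun h h' => nabla_add_left h h' hY) (fun h h' => nabla_smul_left h h' hY) hX hX' h

/-- The connection is torsion-free. -/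
lemma nabla_sub_nabla_swap (hX : SmoothFieldNear X p) (hY : SmoothFieldNear Y p) :
    nabla X Y p - nabla Y X p = bracket X Y p := by
  refine ext_metric fun Z hZ => ?_
  have := koszul_sub_koszul_swap (X := X) (Y := Y) (Z := Z) (p := p)
  rw [metric] at this
  rw [inner_sub_left, inner_nabla hX hY hZ, inner_nabla hY hX hZ]
  linarith

/-- The connection is compatible with the metric. -/
lemma dirDeriv_metric (hX : SmoothFieldNear X p) (hY : SmoothFieldNear Y p)
    (hZ : SmoothFieldNear Z p) :
    dirDeriv X (metric Y Z) p = metric (nabla X Y) Z p + metric Y (nabla X Z) p := by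
  have := koszul_add_koszul_swap (X := X) (Y := Y) (Z := Z) (p := p)
  rw [metric_comm (X := Y) (Y := nabla X Z), metric_nabla hX hY hZ, metric_nabla hX hZ hY]
  linarith

lemma SmoothFunNear.koszul (hX : SmoothFieldNear X p) (hY : SmoothFieldNear Y p)
    (hZ : SmoothFieldNear Z p) : SmoothFunNear n (koszul X Y Z) p := by
  have h := ((((SmoothFunNear.dirDeriv hX (.metric hY hZ)).add
    (.dirDeriv hY (.metric hZ hX))).sub (.dirDeriv hZ (.metric hX hY))).add
    (.metric (.bracket hX hY) hZ)).sub (.metric (.bracket hY hZ) hX) |>.add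
    (.metric (.bracket hZ hX) hY)
  exact h

/-- The basis `onb` in the definition of `nabla` need not vary continuously with the point, but by the
Koszul formula `nabla X Y` has smooth coefficients in a smooth orthonormal frame. -/
lemma SmoothFieldNear.nabla (hX : SmoothFieldNear X p) (hY : SmoothFieldNear Y p) :
    SmoothFieldNear (nabla X Y) p := by
  obtain ⟨E, hE⟩ := exists_orthonormalFrame (n := n) p
  have h : AlmostCosymplectic.nabla X Y =ᶠ[𝓝 p]
      fun q => ∑ i, ((1 / 2 : ℝ) * AlmostCosymplectic.koszul X Y (E i) q) • E i q := by
    have := Filter.eventually_all.2 fun i => (hE.smooth i).eventually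
    filter_upwards [hX.eventually, hY.eventually, hE.orthonormal, this] with q h1 h2 h3 h4
    rw [← sum_inner_smul_of_orthonormal h3 (AlmostCosymplectic.nabla X Y q)]
    refine Finset.sum_congr rfl fun i _ => ?_
    rw [real_inner_comm, inner_nabla h1 h2 (h4 i)]
  refine SmoothFieldNear.congr (.sum fun i _ => ?_) h
  exact .smul (f := (fun _ => (1 / 2 : ℝ)) * AlmostCosymplectic.koszul X Y (E i))
    (.mul (.const _) (.koszul hX hY (hE.smooth i))) (hE.smooth i)

end LeviCivita

/-! ### The curvature tensor -/

section Curvature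

variable {n : ℕ} {M : Type*} [TopologicalSpace M]
  [ChartedSpace (EuclideanSpace ℝ (Fin n)) M] [IsManifold (𝓡 n) ∞ M]
  [RiemannianBundle (fun p : M => TangentSpace (𝓡 n) p)]
  [IsContMDiffRiemannianBundle (𝓡 n) ∞ (EuclideanSpace ℝ (Fin n))
      (fun p : M => TangentSpace (𝓡 n) p)]
  {X Y Z X' Y' Z' : VField n M} {f : M → ℝ} {p : M}

lemma neg_eq_const_smul : -X = (fun _ => (-1 : ℝ) : M → ℝ) • X := by
  ext1 q; simp

lemma nabla_neg_left (hX : SmoothFieldNear X p) (hY : SmoothFieldNear Y p) :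
    nabla (-X) Y p = - nabla X Y p := by
  rw [neg_eq_const_smul, nabla_smul_left (.const _) hX hY]; simp

lemma nabla_neg_right (hX : SmoothFieldNear X p) (hY : SmoothFieldNear Y p) :
    nabla X (-Y) p = - nabla X Y p := by
  rw [neg_eq_const_smul, nabla_smul_right hX (.const _) hY]; simp

lemma nabla_sub_right (hX : SmoothFieldNear X p) (hY : SmoothFieldNear Y p)
    (hY' : SmoothFieldNear Y' p) : nabla X (Y - Y') p = nabla X Y p - nabla X Y' p := by
  rw [sub_eq_add_neg, nabla_add_right hX hY hY'.neg, nabla_neg_right hX hY', sub_eq_add_neg]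

lemma curvatureField_apply (q : M) : curvatureField X Y Z q =
    nabla X (nabla Y Z) q - nabla Y (nabla X Z) q - nabla (bracket X Y) Z q := rfl

lemma curvatureField_congr (hX : X =ᶠ[𝓝 p] X') (hY : Y =ᶠ[𝓝 p] Y') (hZ : Z =ᶠ[𝓝 p] Z') :
    curvatureField X Y Z p = curvatureField X' Y' Z' p := by
  rw [curvatureField_apply, curvatureField_apply, nabla_congr hX (nabla_eventually_congr hY hZ),
    nabla_congr hY (nabla_eventually_congr hX hZ), nabla_congr (bracket_eventually_congr hX hY) hZ]

lemma curvatureField_swap (hX : SmoothFieldNear X p) (hY : SmoothFieldNear Y p)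
    (hZ : SmoothFieldNear Z p) : curvatureField X Y Z p = - curvatureField Y X Z p := by
  rw [curvatureField_apply, curvatureField_apply, bracket_swap (X := X),
    nabla_neg_left (.bracket hY hX) hZ]
  abel

lemma curvatureField_add_left (hX : SmoothFieldNear X p) (hX' : SmoothFieldNear X' p)
    (hY : SmoothFieldNear Y p) (hZ : SmoothFieldNear Z p) :
    curvatureField (X + X') Y Z p = curvatureField X Y Z p + curvatureField X' Y Z p := by
  have h1 : nabla (X + X') Z =ᶠ[𝓝 p] nabla X Z + nabla X' Z := by
    filter_upwards [hX.eventually, hX'.eventually, hZ.eventually] with q h1 h2 h3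
    exact nabla_add_left h1 h2 h3
  have h2 : bracket (X + X') Y =ᶠ[𝓝 p] bracket X Y + bracket X' Y := by
    filter_upwards [hX.eventually, hX'.eventually] with q h1 h2
    exact bracket_add_left h1 h2
  rw [curvatureField_apply, curvatureField_apply, curvatureField_apply,
    nabla_congr (.refl _ Y) h1, nabla_congr h2 (.refl _ Z),
    nabla_add_left hX hX' (.nabla hY hZ), nabla_add_right hY (.nabla hX hZ) (.nabla hX' hZ),
    nabla_add_left (.bracket hX hY) (.bracket hX' hY) hZ]
  abel

lemma curvatureField_smul_left (hf : SmoothFunNear n f p) (hX : SmoothFieldNear X p)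
    (hY : SmoothFieldNear Y p) (hZ : SmoothFieldNear Z p) :
    curvatureField (f • X) Y Z p = f p • curvatureField X Y Z p := by
  have h1 : nabla (f • X) Z =ᶠ[𝓝 p] f • nabla X Z := by
    filter_upwards [hX.eventually, hf.eventually, hZ.eventually] with q h1 h2 h3
    exact nabla_smul_left h2 h1 h3
  have h2 : bracket (f • X) Y =ᶠ[𝓝 p] (-dirDeriv Y f) • X + f • bracket X Y := by
    filter_upwards [hX.eventually, hf.eventually] with q h1 h2
    exact bracket_smul_left h2 h1
  have h3 : SmoothFunNear n (-dirDeriv Y f) p := .neg (.dirDeriv hY hf)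
  rw [curvatureField_apply, curvatureField_apply,
    nabla_congr (.refl _ Y) h1, nabla_congr h2 (.refl _ Z),
    nabla_smul_left hf hX (.nabla hY hZ), nabla_smul_right hY hf (.nabla hX hZ),
    nabla_add_left (.smul h3 hX) (.smul hf (.bracket hX hY)) hZ,
    nabla_smul_left h3 hX hZ, nabla_smul_left hf (.bracket hX hY) hZ, Pi.neg_apply]
  module

lemma curvatureField_add_right (hX : SmoothFieldNear X p) (hY : SmoothFieldNear Y p)
    (hZ : SmoothFieldNear Z p) (hZ' : SmoothFieldNear Z' p) :
    curvatureField X Y (Z + Z') p = curvatureField X Y Z p + curvatureField X Y Z' p := by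
  have h1 : ∀ {X}, SmoothFieldNear X p → nabla X (Z + Z') =ᶠ[𝓝 p] nabla X Z + nabla X Z' := by
    intro X hX
    filter_upwards [hX.eventually, hZ.eventually, hZ'.eventually] with q h1 h2 h3
    exact nabla_add_right h1 h2 h3
  rw [curvatureField_apply, curvatureField_apply, curvatureField_apply,
    nabla_congr (.refl _ Y) (h1 hX), nabla_congr (.refl _ X) (h1 hY),
    nabla_add_right hX (.nabla hY hZ) (.nabla hY hZ'),
    nabla_add_right hY (.nabla hX hZ) (.nabla hX hZ'), nabla_add_right (.bracket hX hY) hZ hZ']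
  abel

lemma curvatureField_smul_right (hX : SmoothFieldNear X p) (hY : SmoothFieldNear Y p)
    (hf : SmoothFunNear n f p) (hZ : SmoothFieldNear Z p) :
    curvatureField X Y (f • Z) p = f p • curvatureField X Y Z p := by
  have h1 : ∀ {X}, SmoothFieldNear X p →
      nabla X (f • Z) =ᶠ[𝓝 p] dirDeriv X f • Z + f • nabla X Z := by
    intro X hX
    filter_upwards [hX.eventually, hf.eventually, hZ.eventually] with q h1 h2 h3
    exact nabla_smul_right h1 h2 h3
  have h2 : ∀ {X}, SmoothFieldNear X p → SmoothFunNear n (dirDeriv X f) p :=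
    fun hX => .dirDeriv hX hf
  rw [curvatureField_apply, curvatureField_apply,
    nabla_congr (.refl _ Y) (h1 hX), nabla_congr (.refl _ X) (h1 hY),
    nabla_add_right hX (.smul (h2 hY) hZ) (.smul hf (.nabla hY hZ)),
    nabla_add_right hY (.smul (h2 hX) hZ) (.smul hf (.nabla hX hZ)),
    nabla_smul_right (.bracket hX hY) hf hZ, nabla_smul_right hX (h2 hY) hZ,
    nabla_smul_right hY (h2 hX) hZ, nabla_smul_right hX hf (.nabla hY hZ),
    nabla_smul_right hY hf (.nabla hX hZ), dirDeriv_bracket hX hY hf]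
  module

/-- The curvature on tangent vectors can be computed with any smooth extensions of them. -/
lemma curvature_eq (hX : SmoothFieldNear X p) (hY : SmoothFieldNear Y p)
    (hZ : SmoothFieldNear Z p) : curvature (X p) (Y p) (Z p) = curvatureField X Y Z p := by
  have hX' := SmoothFieldNear.extendVec (X p)
  have hY' := SmoothFieldNear.extendVec (Y p)
  have hZ' := SmoothFieldNear.extendVec (Z p)
  have h1 : ∀ {X X' Y Z : VField n M}, SmoothFieldNear X p → SmoothFieldNear X' p →
      SmoothFieldNear Y p → SmoothFieldNear Z p → X p = X' p →
      curvatureField X Y Z p = curvatureField X' Y Z p := fun hX hX' hY hZ h =>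
    eq_of_tensorial (T := fun X => curvatureField X _ _ p)
      (fun _ _ h => curvatureField_congr h (.refl _ _) (.refl _ _))
      (fun h h' => curvatureField_add_left h h' hY hZ)
      (fun h h' => curvatureField_smul_left h h' hY hZ) hX hX' h
  have h3 : curvatureField X Y (extendVec (Z p)) p = curvatureField X Y Z p :=
    eq_of_tensorial (T := fun Z => curvatureField X Y Z p)
      (fun _ _ h => curvatureField_congr (.refl _ _) (.refl _ _) h)
      (fun h h' => curvatureField_add_right hX hY h h')
      (fun h h' => curvatureField_smul_right hX hY h h') hZ' hZ (by simp)
  rw [curvature, h1 hX' hX hY' hZ' (by simp), curvatureField_swap hX hY' hZ',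
    h1 hY' hY hX hZ' (by simp), ← curvatureField_swap hX hY hZ', h3]

/-- Skew symmetry of `R(X, Y)`: metric compatibility, applied twice to the commutator of the
derivations `X` and `Y` on the function `g(Z, Z')`. -/
lemma inner_curvatureField_swap (hX : SmoothFieldNear X p) (hY : SmoothFieldNear Y p)
    (hZ : SmoothFieldNear Z p) (hZ' : SmoothFieldNear Z' p) :
    metric (curvatureField X Y Z) Z' p = - metric Z (curvatureField X Y Z') p := by
  have key : ∀ {X Y}, SmoothFieldNear X p → SmoothFieldNear Y p →
      dirDeriv X (dirDeriv Y (metric Z Z')) p =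
        metric (nabla X (nabla Y Z)) Z' p + metric (nabla Y Z) (nabla X Z') p
          + (metric (nabla X Z) (nabla Y Z') p + metric Z (nabla X (nabla Y Z')) p) := by
    intro X Y hX hY
    have h : dirDeriv Y (metric Z Z') =ᶠ[𝓝 p] metric (nabla Y Z) Z' + metric Z (nabla Y Z') := by
      filter_upwards [hY.eventually, hZ.eventually, hZ'.eventually] with q h1 h2 h3
      exact dirDeriv_metric h1 h2 h3
    rw [dirDeriv_congr h, dirDeriv_add (.metric (.nabla hY hZ) hZ') (.metric hZ (.nabla hY hZ')),
      dirDeriv_metric hX (.nabla hY hZ) hZ', dirDeriv_metric hX hZ (.nabla hY hZ')]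
  have h1 := dirDeriv_bracket hX hY (SmoothFunNear.metric hZ hZ')
  rw [key hX hY, key hY hX, dirDeriv_metric (.bracket hX hY) hZ hZ'] at h1
  simp only [metric, curvatureField_apply, inner_sub_left, inner_sub_right] at h1 ⊢
  linarith

/-- The first Bianchi identity: for a torsion-free connection it is the Jacobi identity. -/
lemma curvatureField_bianchi (hX : SmoothFieldNear X p) (hY : SmoothFieldNear Y p)
    (hZ : SmoothFieldNear Z p) :
    curvatureField X Y Z p + curvatureField Y Z X p + curvatureField Z X Y p = 0 := by
  have key : ∀ {X Y Z : VField n M}, SmoothFieldNear X p → SmoothFieldNear Y p →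
      SmoothFieldNear Z p → nabla X (nabla Y Z) p - nabla X (nabla Z Y) p
        - nabla (bracket Y Z) X p = bracket X (bracket Y Z) p := by
    intro X Y Z hX hY hZ
    have h : nabla Y Z - nabla Z Y =ᶠ[𝓝 p] bracket Y Z := by
      filter_upwards [hY.eventually, hZ.eventually] with q h1 h2
      exact nabla_sub_nabla_swap h1 h2
    rw [← nabla_sub_right hX (.nabla hY hZ) (.nabla hZ hY), nabla_congr (.refl _ X) h,
      nabla_sub_nabla_swap hX (.bracket hY hZ)]
  have hJ := jacobi_identity hX hY hZ
  have e1 : bracket (bracket X Y) Z p = - bracket Z (bracket X Y) p := bracket_apply_swap p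
  have e2 : bracket Y (bracket X Z) p = - bracket Y (bracket Z X) p := by
    rw [bracket_swap (X := X) (Y := Z), neg_eq_const_smul,
      bracket_smul_right (.const _) (.bracket hZ hX)]
    simp
  rw [e1, e2, ← key hX hY hZ, ← key hY hZ hX, ← key hZ hX hY] at hJ
  simp only [curvatureField_apply]
  rw [← sub_eq_zero] at hJ
  rw [← hJ]
  abel

section Pointwise

variable (u u' v w z : TangentSpace (𝓡 n) p) (c : ℝ)

lemma curvature_swap : curvature u v w = - curvature v u w :=
  curvatureField_swap (.extendVec u) (.extendVec v) (.extendVec w)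

lemma curvature_add_left : curvature (u + u') v w = curvature u v w + curvature u' v w := by
  have := curvature_eq ((SmoothFieldNear.extendVec u).add (.extendVec u')) (.extendVec v)
    (.extendVec w)
  rw [curvatureField_add_left (.extendVec u) (.extendVec u') (.extendVec v) (.extendVec w)] at this
  simp only [Pi.add_apply, extendVec_self] at this
  exact this

lemma curvature_smul_left : curvature (c • u) v w = c • curvature u v w := by
  have := curvature_eq ((SmoothFieldNear.extendVec u).smul (.const c)) (.extendVec v)
    (.extendVec w)
  rw [curvatureField_smul_left (.const c) (.extendVec u) (.extendVec v) (.extendVec w)] at this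
  simp only [Pi.smul_apply', extendVec_self] at this
  exact this

lemma curvature_add_middle : curvature v (u + u') w = curvature v u w + curvature v u' w := by
  rw [curvature_swap, curvature_add_left, curvature_swap v u, curvature_swap v u', neg_add]

lemma curvature_smul_middle : curvature v (c • u) w = c • curvature v u w := by
  rw [curvature_swap, curvature_smul_left, curvature_swap v u, smul_neg]

lemma curvature_self : curvature u u w = 0 := by
  have h := curvature_swap u u w
  rw [eq_neg_iff_add_eq_zero, ← two_smul ℝ] at h
  simpa using h

lemma inner_curvature_swap :
    inner ℝ (curvature u v w) z = - inner ℝ (curvature u v z) w := by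
  have := inner_curvatureField_swap (SmoothFieldNear.extendVec u) (.extendVec v) (.extendVec w)
    (.extendVec z)
  simpa [metric, curvature, real_inner_comm] using this

lemma curvature_bianchi : curvature u v w + curvature v w u + curvature w u v = 0 :=
  curvatureField_bianchi (.extendVec u) (.extendVec v) (.extendVec w)

/-- The pair symmetry of the curvature tensor, a combination of four instances of the Bianchi
identity. -/
lemma inner_curvature_pair_swap :
    inner ℝ (curvature u v w) z = inner ℝ (curvature w z u) v := by
  have hB : ∀ a b c d : TangentSpace (𝓡 n) p, inner ℝ (curvature a b c) d
      + inner ℝ (curvature b c a) d + inner ℝ (curvature c a b) d = 0 := by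
    intro a b c d
    rw [← inner_add_left, ← inner_add_left, curvature_bianchi, inner_zero_left]
  have hS : ∀ a b c d : TangentSpace (𝓡 n) p,
      inner ℝ (curvature a b c) d = - inner ℝ (curvature b a c) d := by
    intro a b c d
    rw [curvature_swap, inner_neg_left]
  have hT := @inner_curvature_swap n M _ _ _ _ _ p
  linarith [hB u v w z, hB v w z u, hB w z u v, hB z u v w, hT u v w z, hT v w u z, hT w u v z,
    hT v w z u, hT w z v u, hT z v w u, hS z v w u, hT w z u v, hT z u w v, hT u w z v, hS u w z v,
    hT z u v w, hT u v z w, hT v z u w, hS v z u w, hS w u v z, hS w u z v, hS v z w u]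

variable (p) in
/-- The trace of an endomorphism, computed in the basis `onb p`, can be computed in any
orthonormal family of `n` vectors. -/
lemma sum_inner_onb (T : TangentSpace (𝓡 n) p →ₗ[ℝ] TangentSpace (𝓡 n) p)
    {E : Fin n → TangentSpace (𝓡 n) p} (hE : Orthonormal ℝ E) :
    ∑ i, inner ℝ (T (onb p i)) (onb p i) = ∑ i, inner ℝ (T (E i)) (E i) := by
  have hs : ⊤ ≤ Submodule.span ℝ (Set.range E) := by
    rw [hE.linearIndependent.span_eq_top_of_card_eq_finrank']
    simp [finrank_tangentSpace]
  have h1 := T.trace_eq_sum_inner (onb p)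
  have h2 := T.trace_eq_sum_inner (OrthonormalBasis.mk hE hs)
  simp only [OrthonormalBasis.coe_mk] at h2
  simp only [real_inner_comm]
  rw [← h1, ← h2]

/-- The curvature as a linear map in its first argument. -/
def curvatureMap : TangentSpace (𝓡 n) p →ₗ[ℝ] TangentSpace (𝓡 n) p where
  toFun u := curvature u v w
  map_add' u u' := curvature_add_left u u' v w
  map_smul' c u := curvature_smul_left u v w c

lemma ricci_eq_sum {E : Fin n → TangentSpace (𝓡 n) p} (hE : Orthonormal ℝ E) :
    ricci v w = ∑ i, inner ℝ (curvature (E i) v w) (E i) :=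
  sum_inner_onb p (curvatureMap v w) hE

end Pointwise

end Curvature

/-! ### Almost contact metric structures and the tensor `h` -/

namespace AlmostContactMetric

section Algebra

variable {n : ℕ} {M : Type*} [TopologicalSpace M]
  [ChartedSpace (EuclideanSpace ℝ (Fin n)) M] [IsManifold (𝓡 n) ∞ M]
  [RiemannianBundle (fun p : M => TangentSpace (𝓡 n) p)]
  (A : AlmostContactMetric n M) {p : M}

lemma xi_ne_zero (p : M) : A.xi p ≠ 0 := by
  intro h
  have := A.eta_xi p
  simp [h] at this

lemma phi_xi (p : M) : A.phi p (A.xi p) = 0 := by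
  have h1 : A.phi p (A.phi p (A.xi p)) = 0 := by simp [A.phi_phi, A.eta_xi]
  have h2 := A.phi_phi p (A.phi p (A.xi p))
  rw [h1, map_zero] at h2
  have h3 : A.phi p (A.xi p) = A.eta p (A.phi p (A.xi p)) • A.xi p := by
    rw [← sub_eq_zero, ← neg_eq_zero, h2]; abel
  have h4 : A.eta p (A.phi p (A.xi p)) * A.eta p (A.phi p (A.xi p)) = 0 := by
    have : (A.eta p (A.phi p (A.xi p)) * A.eta p (A.phi p (A.xi p))) • A.xi p = 0 := by
      rw [mul_smul, ← h3, ← map_smul, ← h3, h1]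
    exact (smul_eq_zero.1 this).resolve_right (A.xi_ne_zero p)
  rw [h3, mul_self_eq_zero.1 h4, zero_smul]

lemma eta_phi (u : TangentSpace (𝓡 n) p) : A.eta p (A.phi p u) = 0 := by
  have h := A.phi_phi p (A.phi p u)
  rw [A.phi_phi p u, map_add, map_neg, map_smul, A.phi_xi, smul_zero, add_zero, left_eq_add] at h
  exact (smul_eq_zero.1 h).resolve_right (A.xi_ne_zero p)

lemma eta_eq_inner (u : TangentSpace (𝓡 n) p) : A.eta p u = inner ℝ (A.xi p) u := by
  have h := A.compatible p (A.xi p) u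
  rw [A.phi_xi, inner_zero_left, A.eta_xi, one_mul] at h
  linarith

lemma inner_xi_xi (p : M) : inner ℝ (A.xi p) (A.xi p) = (1 : ℝ) := by
  rw [← A.eta_eq_inner, A.eta_xi]

lemma inner_phi_left (u v : TangentSpace (𝓡 n) p) :
    inner ℝ (A.phi p u) v = - inner ℝ u (A.phi p v) := by
  have h := A.compatible p u (A.phi p v)
  rw [A.phi_phi, A.eta_phi, inner_add_right, inner_neg_right, real_inner_smul_right,
    real_inner_comm (A.xi p), ← A.eta_eq_inner, A.eta_phi] at h
  linarith

lemma inner_self_phi (u : TangentSpace (𝓡 n) p) : inner ℝ u (A.phi p u) = (0 : ℝ) := by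
  have := A.inner_phi_left u u
  rw [real_inner_comm] at this
  linarith

end Algebra

section Dimension3

variable {M : Type*} [TopologicalSpace M]
  [ChartedSpace (EuclideanSpace ℝ (Fin 3)) M] [IsManifold (𝓡 3) ∞ M]
  [RiemannianBundle (fun p : M => TangentSpace (𝓡 3) p)]
  (A : AlmostContactMetric 3 M) {p : M} {u : TangentSpace (𝓡 3) p}

lemma orthonormal_phi_basis (h1 : inner ℝ u u = (1 : ℝ)) (h2 : A.eta p u = 0) :
    Orthonormal ℝ ![u, A.phi p u, A.xi p] := by
  have e1 : inner ℝ (A.phi p u) (A.phi p u) = (1 : ℝ) := by rw [A.compatible, h1, h2]; ring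
  have e2 : inner ℝ u (A.xi p) = (0 : ℝ) := by rw [real_inner_comm, ← A.eta_eq_inner, h2]
  have e3 : inner ℝ (A.phi p u) (A.xi p) = (0 : ℝ) := by
    rw [real_inner_comm, ← A.eta_eq_inner, A.eta_phi]
  have e4 := A.inner_self_phi u
  have e5 := A.inner_xi_xi p
  have e6 : inner ℝ (A.phi p u) u = (0 : ℝ) := by rw [real_inner_comm, e4]
  have e7 : inner ℝ (A.xi p) u = (0 : ℝ) := by rw [real_inner_comm, e2]
  have e8 : inner ℝ (A.xi p) (A.phi p u) = (0 : ℝ) := by rw [real_inner_comm, e3]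
  rw [orthonormal_iff_ite]
  intro i j
  fin_cases i <;> fin_cases j <;>
    simp [-inner_self_eq_norm_sq_to_K, h1, e1, e2, e3, e4, e5, e6, e7, e8]

lemma phi_basis_expansion (h1 : inner ℝ u u = (1 : ℝ)) (h2 : A.eta p u = 0)
    (v : TangentSpace (𝓡 3) p) :
    v = inner ℝ u v • u + inner ℝ (A.phi p u) v • A.phi p u + A.eta p v • A.xi p := by
  have := sum_inner_smul_of_orthonormal (A.orthonormal_phi_basis h1 h2) v
  rw [Fin.sum_univ_three] at this
  rw [A.eta_eq_inner]
  exact this.symm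

lemma exists_unit_eta_eq_zero (p : M) :
    ∃ u : TangentSpace (𝓡 3) p, inner ℝ u u = (1 : ℝ) ∧ A.eta p u = 0 := by
  have : 0 < Module.finrank ℝ (LinearMap.ker (A.eta p).toLinearMap) := by
    have h1 := LinearMap.finrank_range_add_finrank_ker (A.eta p).toLinearMap
    have h2 := Submodule.finrank_le (LinearMap.range (A.eta p).toLinearMap)
    rw [finrank_tangentSpace] at h1
    rw [Module.finrank_self] at h2
    omega
  have := Module.finrank_pos_iff.1 this
  obtain ⟨⟨u, hu⟩, hu0⟩ := exists_ne (0 : LinearMap.ker (A.eta p).toLinearMap)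
  have hu0' : u ≠ 0 := by simpa using hu0
  have hu' : A.eta p u = 0 := hu
  refine ⟨(‖u‖⁻¹ : ℝ) • u, ?_, ?_⟩
  · rw [real_inner_smul_left, real_inner_smul_right, real_inner_self_eq_norm_sq]
    have := norm_ne_zero_iff.2 hu0'
    field_simp
  · simp [hu']

end Dimension3

section Calculus

variable {n : ℕ} {M : Type*} [TopologicalSpace M]
  [ChartedSpace (EuclideanSpace ℝ (Fin n)) M] [IsManifold (𝓡 n) ∞ M]
  [RiemannianBundle (fun p : M => TangentSpace (𝓡 n) p)]
  [IsContMDiffRiemannianBundle (𝓡 n) ∞ (EuclideanSpace ℝ (Fin n))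
      (fun p : M => TangentSpace (𝓡 n) p)]
  (A : AlmostContactMetric n M) {X Y Z X' Y' : VField n M} {f : M → ℝ} {p : M} {α : ℝ}

lemma smooth_xi_near (p : M) : SmoothFieldNear A.xi p :=
  Filter.Eventually.of_forall fun q => (A.smooth_xi q trivial).contMDiffAt Filter.univ_mem

lemma smooth_phiF (hX : SmoothFieldNear X p) : SmoothFieldNear (A.phiF X) p := by
  filter_upwards [hX] with q hq
  exact ContMDiffAt.clm_bundle_apply (A.smooth_phi q) hq

lemma etaF_eq (X : VField n M) : A.etaF X = metric A.xi X := by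
  ext q; exact A.eta_eq_inner _

lemma phiF_add : A.phiF (X + Y) = A.phiF X + A.phiF Y := by
  ext1 q; exact map_add _ _ _

lemma phiF_smul : A.phiF (f • X) = f • A.phiF X := by
  ext1 q; exact map_smul (A.phi q) (f q) (X q)

lemma phiF_congr (h : X =ᶠ[𝓝 p] Y) : A.phiF X =ᶠ[𝓝 p] A.phiF Y := by
  filter_upwards [h] with q hq
  rw [phiF, phiF, hq]

/-- The tensor `h` can be computed with any smooth extension of a vector. -/
lemma h_eq (hX : SmoothFieldNear X p) :
    A.h (X p) = (1 / 2 : ℝ) • (bracket A.xi (A.phiF X) p - A.phi p (bracket A.xi X p)) := by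
  refine eq_of_tensorial (T := fun X => (1 / 2 : ℝ) • (bracket A.xi (A.phiF X) p
    - A.phi p (bracket A.xi X p))) (fun {X Y} _ _ h => ?_) (fun {X Y} hX hY => ?_)
    (fun {f X} hf hX => ?_) (.extendVec (X p)) hX (by simp)
  · simp only [bracket_congr (.refl _ A.xi) (A.phiF_congr h), bracket_congr (.refl _ A.xi) h]
  · simp only [phiF_add, bracket_add_right hX hY,
      bracket_add_right (A.smooth_phiF hX) (A.smooth_phiF hY), map_add]
    module
  · simp only [phiF_smul, bracket_smul_right hf hX,
      bracket_smul_right hf (A.smooth_phiF hX), map_add, map_smul]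
    simp only [phiF]
    module

lemma h_add (u v : TangentSpace (𝓡 n) p) : A.h (u + v) = A.h u + A.h v := by
  have hu := SmoothFieldNear.extendVec u
  have hv := SmoothFieldNear.extendVec v
  have h1 := A.h_eq (hu.add hv)
  rw [phiF_add, bracket_add_right hu hv,
      bracket_add_right (A.smooth_phiF hu) (A.smooth_phiF hv), map_add] at h1
  simp only [Pi.add_apply, extendVec_self] at h1
  rw [h1, h, h]
  module

lemma h_smul (c : ℝ) (u : TangentSpace (𝓡 n) p) : A.h (c • u) = c • A.h u := by
  have hu := SmoothFieldNear.extendVec u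
  have h1 := A.h_eq (hu.smul (.const c))
  rw [phiF_smul, bracket_smul_right (.const c) hu,
      bracket_smul_right (.const c) (A.smooth_phiF hu), map_add] at h1
  simp only [Pi.smul_apply', extendVec_self, dirDeriv_const, zero_smul, map_zero, zero_add,
    map_smul] at h1
  rw [h1, h]
  module

variable (p) in
/-- The tensor `h` at `p` as a linear map. -/
def hMap : TangentSpace (𝓡 n) p →ₗ[ℝ] TangentSpace (𝓡 n) p where
  toFun u := A.h u
  map_add' := A.h_add
  map_smul' := A.h_smul

lemma h_xi (p : M) : A.h (A.xi p) = 0 := by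
  have h0 : A.phiF A.xi = 0 := by
    ext1 q; exact A.phi_xi q
  rw [A.h_eq (A.smooth_xi_near p), h0]
  simp [bracket]

lemma inner_nabla_xi_xi (hX : SmoothFieldNear X p) :
    inner ℝ (nabla X A.xi p) (A.xi p) = (0 : ℝ) := by
  have hξ := A.smooth_xi_near p
  have h1 := dirDeriv_metric hX hξ hξ
  have h2 : metric A.xi A.xi = fun _ => 1 := by ext q; exact A.inner_xi_xi q
  rw [h2, dirDeriv_const, metric_comm (X := A.xi), metric] at h1
  linarith

variable {A}

/-- As `η` is closed, `∇ξ` is symmetric. -/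
lemma IsAlmostCosymplectic.inner_nabla_xi_comm (hA : A.IsAlmostCosymplectic α)
    (hX : SmoothFieldNear X p) (hY : SmoothFieldNear Y p) :
    inner ℝ (nabla X A.xi p) (Y p) = inner ℝ (nabla Y A.xi p) (X p) := by
  have hξ := A.smooth_xi_near p
  have h := hA.1 p X Y hX.smoothAt hY.smoothAt
  rw [dEta, A.etaF_eq, A.etaF_eq, A.etaF_eq, dirDeriv_metric hX hξ hY, dirDeriv_metric hY hξ hX,
    metric, metric, metric, metric, metric, ← nabla_sub_nabla_swap hX hY, inner_sub_right] at h
  linarith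

/-- The integral curves of `ξ` are geodesics. -/
lemma IsAlmostCosymplectic.nabla_xi_xi (hA : A.IsAlmostCosymplectic α) (p : M) :
    nabla A.xi A.xi p = 0 := by
  refine ext_metric fun Z hZ => ?_
  rw [hA.inner_nabla_xi_comm (A.smooth_xi_near p) hZ, A.inner_nabla_xi_xi hZ, inner_zero_left]

end Calculus

end AlmostContactMetric

/-! ### Adapted frames -/

namespace AlmostContactMetric

section Dimension3

variable {M : Type*} [TopologicalSpace M]
  [ChartedSpace (EuclideanSpace ℝ (Fin 3)) M] [IsManifold (𝓡 3) ∞ M]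
  [RiemannianBundle (fun p : M => TangentSpace (𝓡 3) p)]
  [IsContMDiffRiemannianBundle (𝓡 3) ∞ (EuclideanSpace ℝ (Fin 3))
      (fun p : M => TangentSpace (𝓡 3) p)]
  {A : AlmostContactMetric 3 M} {X Y Z e : VField 3 M} {f : M → ℝ} {p : M} {α : ℝ}
  {u : TangentSpace (𝓡 3) p}

variable (A) in
/-- Around `p`, the field `e` is a smooth unit field with values in `ker η`; equivalently
`(e, φ e, ξ)` is a smooth local orthonormal frame. -/
structure IsAdapted (e : VField 3 M) (p : M) : Prop where
  smooth : SmoothFieldNear e p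
  unit : ∀ᶠ q in 𝓝 p, inner ℝ (e q) (e q) = (1 : ℝ)
  eta : ∀ᶠ q in 𝓝 p, A.eta q (e q) = 0

lemma IsAdapted.eventually (he : A.IsAdapted e p) : ∀ᶠ q in 𝓝 p, A.IsAdapted e q := by
  filter_upwards [he.smooth.eventually, eventually_eventually_nhds.2 he.unit,
    eventually_eventually_nhds.2 he.eta] with q h1 h2 h3 using ⟨h1, h2, h3⟩

lemma IsAdapted.phiF (he : A.IsAdapted e p) : A.IsAdapted (A.phiF e) p where
  smooth := A.smooth_phiF he.smooth
  unit := by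
    filter_upwards [he.unit, he.eta] with q h1 h2
    simp only [AlmostContactMetric.phiF]
    rw [A.compatible, h1, h2]; ring
  eta := Filter.Eventually.of_forall fun q => A.eta_phi _

lemma IsAdapted.phiF_phiF (he : A.IsAdapted e p) : A.phiF (A.phiF e) =ᶠ[𝓝 p] -e := by
  filter_upwards [he.eta] with q hq
  simp only [AlmostContactMetric.phiF]
  rw [A.phi_phi, hq, zero_smul, add_zero]
  rfl

/-- A nonvanishing field in `ker η` can be normalised. -/
lemma isAdapted_normalize (hY : SmoothFieldNear Y p) (hη : ∀ᶠ q in 𝓝 p, A.eta q (Y q) = 0)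
    (h0 : metric Y Y p ≠ 0) :
    A.IsAdapted ((fun q => (Real.sqrt (metric Y Y q))⁻¹) • Y) p where
  smooth := .smul (.inv (.sqrt (.metric hY hY) h0)
    (Real.sqrt_pos.2 (lt_of_le_of_ne real_inner_self_nonneg h0.symm)).ne') hY
  unit := by
    have h1 : ∀ᶠ q in 𝓝 p, metric Y Y q ≠ 0 :=
      (SmoothFunNear.metric hY hY).mdiff.continuousAt.eventually_ne h0
    filter_upwards [h1] with q hq
    have h2 : 0 ≤ metric Y Y q := real_inner_self_nonneg
    have h3 := Real.mul_self_sqrt h2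
    have h4 : Real.sqrt (metric Y Y q) ≠ 0 := fun h => hq (by rw [← h3, h, zero_mul])
    rw [Pi.smul_apply', real_inner_smul_left, real_inner_smul_right]
    change _ * (_ * metric Y Y q) = 1
    field_simp
    rw [sq, h3]
  eta := by
    filter_upwards [hη] with q hq
    simp [hq]

/-- Every unit vector in `ker η` extends to an adapted frame: subtract the `ξ`-component from any
smooth extension and normalise. -/
lemma exists_isAdapted (h1 : inner ℝ u u = (1 : ℝ)) (h2 : A.eta p u = 0) :
    ∃ e, A.IsAdapted e p ∧ e p = u := by
  let X : VField 3 M := extendVec u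
  have hX : SmoothFieldNear X p := .extendVec u
  let Y : VField 3 M := X - metric A.xi X • A.xi
  have hξ := A.smooth_xi_near p
  have hY : SmoothFieldNear Y p := .sub hX (.smul (.metric hξ hX) hξ)
  have hYp : Y p = u := by simp [Y, X, metric, ← A.eta_eq_inner, h2]
  have hYY : metric Y Y p = 1 := by rw [metric, hYp, h1]
  refine ⟨_, isAdapted_normalize hY (Filter.Eventually.of_forall fun q => ?_) (by simp [hYY]), ?_⟩
  · simp [Y, metric, ← A.eta_eq_inner, A.eta_xi]
  · simp [hYY, hYp]

lemma inner_nabla_of_const {c : ℝ} (hX : SmoothFieldNear X p) (hY : SmoothFieldNear Y p)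
    (hZ : SmoothFieldNear Z p) (h : metric Y Z =ᶠ[𝓝 p] fun _ => c) :
    metric (nabla X Y) Z p = - metric Y (nabla X Z) p := by
  have := dirDeriv_metric hX hY hZ
  rw [dirDeriv_congr h, dirDeriv_const] at this
  linarith

section Adapted

variable (he : A.IsAdapted e p)
include he

lemma IsAdapted.expansion (v : TangentSpace (𝓡 3) p) :
    v = inner ℝ (e p) v • e p + inner ℝ (A.phiF e p) v • A.phiF e p
      + inner ℝ (A.xi p) v • A.xi p := by
  rw [← A.eta_eq_inner]
  exact A.phi_basis_expansion he.unit.self_of_nhds he.eta.self_of_nhds v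

lemma IsAdapted.metric_self : metric e e =ᶠ[𝓝 p] fun _ => 1 := he.unit

lemma IsAdapted.metric_phi : metric e (A.phiF e) =ᶠ[𝓝 p] fun _ => 0 :=
  Filter.Eventually.of_forall fun _ => A.inner_self_phi _

lemma IsAdapted.metric_xi : metric e A.xi =ᶠ[𝓝 p] fun _ => 0 := by
  filter_upwards [he.eta] with q hq
  rw [metric, real_inner_comm, ← A.eta_eq_inner, hq]

lemma IsAdapted.metric_nabla_self (hX : SmoothFieldNear X p) : metric (nabla X e) e p = 0 := by
  have := inner_nabla_of_const hX he.smooth he.smooth he.metric_self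
  rw [metric_comm (X := e)] at this
  linarith

/-- As `ξ` has unit length, `∇ξ` takes values in `ker η`. -/
lemma IsAdapted.nabla_self_xi :
    nabla e A.xi p = metric (nabla e A.xi) e p • e p
      + metric (nabla e A.xi) (A.phiF e) p • A.phiF e p := by
  have h := A.inner_nabla_xi_xi he.smooth
  rw [real_inner_comm] at h
  conv_lhs => rw [he.expansion (nabla e A.xi p), h, zero_smul, add_zero]
  simp only [metric, real_inner_comm]

variable (hA : A.IsAlmostCosymplectic α)
include hA

lemma IsAdapted.metric_nabla_xi_xi : metric (nabla A.xi e) A.xi p = 0 := by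
  rw [inner_nabla_of_const (A.smooth_xi_near p) he.smooth (A.smooth_xi_near p) he.metric_xi,
    metric, hA.nabla_xi_xi, inner_zero_right, neg_zero]

lemma IsAdapted.nabla_xi_phiF :
    nabla A.xi (A.phiF e) p = metric e (nabla A.xi (A.phiF e)) p • e p := by
  have hφ := he.phiF
  have h1 := hφ.metric_nabla_self (A.smooth_xi_near p)
  have h2 := hφ.metric_nabla_xi_xi hA
  rw [metric, real_inner_comm] at h1 h2
  conv_lhs => rw [he.expansion (nabla A.xi (A.phiF e) p), h1, h2, zero_smul, zero_smul, add_zero,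
    add_zero]
  rfl

lemma IsAdapted.nabla_xi_self :
    nabla A.xi e p = -(metric e (nabla A.xi (A.phiF e)) p • A.phiF e p) := by
  have h1 := he.metric_nabla_self (A.smooth_xi_near p)
  have h2 := he.metric_nabla_xi_xi hA
  have h3 := inner_nabla_of_const (A.smooth_xi_near p) he.smooth he.phiF.smooth he.metric_phi
  rw [metric, real_inner_comm] at h1 h2 h3
  conv_lhs => rw [he.expansion (nabla A.xi e p), h1, h2, h3, zero_smul, zero_smul, add_zero,
    zero_add, neg_smul]

/-- By the symmetry of `∇ξ`, the off-diagonal coefficient is the one of `∇_e ξ`. -/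
lemma IsAdapted.nabla_phiF_xi :
    nabla (A.phiF e) A.xi p = metric (nabla e A.xi) (A.phiF e) p • e p
      + metric (nabla (A.phiF e) A.xi) (A.phiF e) p • A.phiF e p := by
  have h := A.inner_nabla_xi_xi he.phiF.smooth
  rw [real_inner_comm] at h
  conv_lhs => rw [he.expansion (nabla (A.phiF e) A.xi p), h, zero_smul, add_zero]
  rw [metric, hA.inner_nabla_xi_comm he.smooth he.phiF.smooth]
  simp only [metric, real_inner_comm]

/-- Evaluating `dΦ = 2α η ∧ Φ` on an adapted frame gives `div ξ = 2α`. -/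
lemma IsAdapted.div_xi :
    metric (nabla e A.xi) e p + metric (nabla (A.phiF e) A.xi) (A.phiF e) p = 2 * α := by
  have hξ := A.smooth_xi_near p
  have hφ := he.phiF
  have h := hA.2 p e (A.phiF e) A.xi he.smooth.smoothAt hφ.smooth.smoothAt hξ.smoothAt
  have c1 : A.Phi (A.phiF e) A.xi = fun _ => 0 := by
    ext q
    rw [Phi, real_inner_comm, ← A.eta_eq_inner, A.eta_phi]
  have c2 : A.Phi A.xi e = fun _ => 0 := by
    ext q
    rw [Phi, A.phi_xi, inner_zero_left]
  have c3 : A.Phi e (A.phiF e) =ᶠ[𝓝 p] fun _ => 1 := hφ.unit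
  have c4 : A.Phi (bracket e (A.phiF e)) A.xi p = 0 := by
    rw [Phi, real_inner_comm, ← A.eta_eq_inner, A.eta_phi]
  have c5 : A.Phi (bracket (A.phiF e) A.xi) e p =
      - metric (nabla (A.phiF e) A.xi) (A.phiF e) p := by
    rw [Phi, A.inner_phi_left, ← nabla_sub_nabla_swap hφ.smooth hξ, inner_sub_left]
    have := hφ.metric_nabla_self hξ
    change - (metric _ (A.phiF e) p - metric _ (A.phiF e) p) = _
    rw [this, sub_zero]
  have c6 : A.Phi (bracket A.xi e) (A.phiF e) p = - metric (nabla e A.xi) e p := by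
    have h1 : A.Phi (bracket A.xi e) (A.phiF e) p = metric (bracket A.xi e) e p := by
      rw [Phi, AlmostContactMetric.phiF, A.compatible, he.eta.self_of_nhds, mul_zero, sub_zero,
        metric]
    have := he.metric_nabla_self hξ
    rw [h1, metric, ← nabla_sub_nabla_swap hξ he.smooth, inner_sub_left]
    change metric _ e p - metric _ e p = _
    rw [this, zero_sub]
  have c7 : A.etaF A.xi p = 1 := A.eta_xi p
  have c8 : A.etaF e p = 0 := he.eta.self_of_nhds
  have c9 : A.etaF (A.phiF e) p = 0 := A.eta_phi _
  rw [dPhi, etaWedgePhi, dirDeriv_congr c3, c1, c2, c3.self_of_nhds, c4, c5, c6, c7, c8, c9] at h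
  simp only [dirDeriv_const] at h
  linarith

/-- On `ker η` the tensor `h` is `∇ξ - α` followed by `φ`, written out in an adapted frame. -/
lemma IsAdapted.h_self :
    A.h (e p) = -(metric (nabla e A.xi) (A.phiF e) p) • e p
      + (metric (nabla e A.xi) e p - α) • A.phiF e p := by
  have hξ := A.smooth_xi_near p
  have hφ := he.phiF
  have h1 := he.div_xi hA
  rw [A.h_eq he.smooth, ← nabla_sub_nabla_swap hξ he.smooth, ← nabla_sub_nabla_swap hξ hφ.smooth,
    he.nabla_xi_phiF hA, he.nabla_xi_self hA, he.nabla_self_xi, he.nabla_phiF_xi hA]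
  have h2 : A.phi p (A.phiF e p) = - e p := he.phiF_phiF.self_of_nhds
  have h3 : A.phi p (e p) = A.phiF e p := rfl
  simp only [map_sub, map_add, map_neg, map_smul, h2, h3]
  rw [show metric (nabla (A.phiF e) A.xi) (A.phiF e) p = 2 * α - metric (nabla e A.xi) e p by
    linarith]
  module

lemma IsAdapted.h_phiF :
    A.h (A.phiF e p) = (metric (nabla e A.xi) e p - α) • e p
      + metric (nabla e A.xi) (A.phiF e) p • A.phiF e p := by
  have hξ := A.smooth_xi_near p
  have hφ := he.phiF
  have h1 := he.div_xi hA
  have h4 : nabla A.xi (A.phiF (A.phiF e)) p = - nabla A.xi e p := by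
    rw [nabla_congr (.refl _ A.xi) he.phiF_phiF, nabla_neg_right hξ he.smooth]
  have h5 : nabla (A.phiF (A.phiF e)) A.xi p = - nabla e A.xi p := by
    rw [nabla_congr he.phiF_phiF (.refl _ A.xi), nabla_neg_left he.smooth hξ]
  rw [A.h_eq hφ.smooth, ← nabla_sub_nabla_swap hξ hφ.phiF.smooth,
    ← nabla_sub_nabla_swap hξ hφ.smooth, h4, h5,
    he.nabla_xi_phiF hA, he.nabla_xi_self hA, he.nabla_self_xi, he.nabla_phiF_xi hA]
  have h2 : A.phi p (A.phiF e p) = - e p := he.phiF_phiF.self_of_nhds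
  have h3 : A.phi p (e p) = A.phiF e p := rfl
  simp only [map_sub, map_add, map_smul, h2, h3]
  rw [show metric (nabla (A.phiF e) A.xi) (A.phiF e) p = 2 * α - metric (nabla e A.xi) e p by
    linarith]
  module

end Adapted

end Dimension3

end AlmostContactMetric

/-! ### The eigenvalue `λ` and eigenframes of `h` -/

namespace AlmostContactMetric

section Eigenframes

variable {M : Type*} [TopologicalSpace M]
  [ChartedSpace (EuclideanSpace ℝ (Fin 3)) M] [IsManifold (𝓡 3) ∞ M]
  [RiemannianBundle (fun p : M => TangentSpace (𝓡 3) p)]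
  [IsContMDiffRiemannianBundle (𝓡 3) ∞ (EuclideanSpace ℝ (Fin 3))
      (fun p : M => TangentSpace (𝓡 3) p)]
  {A : AlmostContactMetric 3 M} {X Y Z e : VField 3 M} {f : M → ℝ} {p : M} {α : ℝ}
  {u : TangentSpace (𝓡 3) p} {P Q : ℝ}

variable (A) in
/-- The trace of an endomorphism of the tangent space at `p` in the orthonormal basis
`(u, φ u, ξ)`. -/
lemma sum_inner_onb_phi (T : TangentSpace (𝓡 3) p →ₗ[ℝ] TangentSpace (𝓡 3) p)
    (h1 : inner ℝ u u = (1 : ℝ)) (h2 : A.eta p u = 0) :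
    ∑ i, inner ℝ (T (onb p i)) (onb p i) = inner ℝ (T u) u
      + inner ℝ (T (A.phi p u)) (A.phi p u) + inner ℝ (T (A.xi p)) (A.xi p) := by
  rw [sum_inner_onb p T (A.orthonormal_phi_basis h1 h2), Fin.sum_univ_three]
  rfl

variable (A) in
/-- The function `tr(h²)/2`. It is smooth on all of `M`, unlike its square root. -/
def lamSq (p : M) : ℝ := (1 / 2 : ℝ) * ∑ i, inner ℝ (A.h (A.h (onb p i))) (onb p i)

variable (A) in
/-- The non-negative eigenvalue of `h` on `ker η`. -/
def lam (p : M) : ℝ := Real.sqrt (A.lamSq p)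

/-- On `ker η`, the tensor `h` is symmetric and trace-free. -/
lemma IsAlmostCosymplectic.exists_h_eq (hA : A.IsAlmostCosymplectic α)
    (h1 : inner ℝ u u = (1 : ℝ)) (h2 : A.eta p u = 0) :
    ∃ P Q : ℝ, A.h u = P • u + Q • A.phi p u ∧ A.h (A.phi p u) = Q • u - P • A.phi p u := by
  obtain ⟨e, he, rfl⟩ := exists_isAdapted h1 h2
  refine ⟨-(metric (nabla e A.xi) (A.phiF e) p), metric (nabla e A.xi) e p - α,
    he.h_self hA, ?_⟩
  rw [neg_smul, sub_neg_eq_add]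
  exact he.h_phiF hA

/-- A symmetric trace-free endomorphism of a plane squares to a multiple of the identity. -/
lemma h_h_eq (hu : A.h u = P • u + Q • A.phi p u)
    (hφ : A.h (A.phi p u) = Q • u - P • A.phi p u) :
    A.h (A.h u) = (P ^ 2 + Q ^ 2) • u ∧
      A.h (A.h (A.phi p u)) = (P ^ 2 + Q ^ 2) • A.phi p u := by
  constructor
  · rw [hu, h_add, h_smul, h_smul, hu, hφ]; module
  · rw [hφ, sub_eq_add_neg, ← neg_smul, h_add, h_smul, h_smul, hu, hφ]; module

lemma lamSq_eq (h1 : inner ℝ u u = (1 : ℝ)) (h2 : A.eta p u = 0)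
    (hu : A.h u = P • u + Q • A.phi p u) (hφ : A.h (A.phi p u) = Q • u - P • A.phi p u) :
    A.lamSq p = P ^ 2 + Q ^ 2 := by
  have h3 := A.sum_inner_onb_phi ((A.hMap p).comp (A.hMap p)) h1 h2
  obtain ⟨h4, h5⟩ := h_h_eq hu hφ
  have h6 : inner ℝ (A.phi p u) (A.phi p u) = (1 : ℝ) := by rw [A.compatible, h1, h2]; ring
  have h7 : A.h (A.h (A.xi p)) = 0 := by
    rw [A.h_xi]
    exact map_zero (A.hMap p)
  change ∑ i, inner ℝ (A.h (A.h (onb p i))) (onb p i) = inner ℝ (A.h (A.h u)) u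
    + inner ℝ (A.h (A.h (A.phi p u))) (A.phi p u) + inner ℝ (A.h (A.h (A.xi p))) (A.xi p) at h3
  rw [lamSq, h3, h4, h5, h7, real_inner_smul_left, real_inner_smul_left, h1, h6, inner_zero_left]
  ring

lemma IsAlmostCosymplectic.lamSq_nonneg (hA : A.IsAlmostCosymplectic α) (p : M) :
    0 ≤ A.lamSq p := by
  obtain ⟨u, h1, h2⟩ := A.exists_unit_eta_eq_zero p
  obtain ⟨P, Q, h3, h4⟩ := hA.exists_h_eq h1 h2
  rw [lamSq_eq h1 h2 h3 h4]
  positivity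

lemma IsAlmostCosymplectic.lam_sq (hA : A.IsAlmostCosymplectic α) (p : M) :
    A.lam p ^ 2 = A.lamSq p := Real.sq_sqrt (hA.lamSq_nonneg p)

lemma IsAlmostCosymplectic.h_eq_zero_iff (hA : A.IsAlmostCosymplectic α) :
    (∀ u : TangentSpace (𝓡 3) p, A.h u = 0) ↔ A.lam p = 0 := by
  obtain ⟨u, h1, h2⟩ := A.exists_unit_eta_eq_zero p
  obtain ⟨P, Q, h3, h4⟩ := hA.exists_h_eq h1 h2
  rw [← sq_eq_zero_iff, hA.lam_sq, lamSq_eq h1 h2 h3 h4]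
  have h6 : inner ℝ (A.phi p u) (A.phi p u) = (1 : ℝ) := by rw [A.compatible, h1, h2]; ring
  constructor
  · intro h
    rw [h u] at h3
    have h7 : (0 : ℝ) = P := by
      simpa [inner_add_right, real_inner_smul_right, h1, A.inner_self_phi,
        -inner_self_eq_norm_sq_to_K]
        using congrArg (inner ℝ u) h3
    have h9 : inner ℝ (A.phi p u) u = (0 : ℝ) := by rw [real_inner_comm, A.inner_self_phi]
    have h8 : (0 : ℝ) = Q := by
      simpa [inner_add_right, real_inner_smul_right, h6, h9, -inner_self_eq_norm_sq_to_K]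
        using congrArg (inner ℝ (A.phi p u)) h3
    rw [← h7, ← h8]; ring
  · intro h v
    have hP : P = 0 := by nlinarith [sq_nonneg P, sq_nonneg Q]
    have hQ : Q = 0 := by nlinarith [sq_nonneg P, sq_nonneg Q]
    rw [A.phi_basis_expansion h1 h2 v, h_add, h_add, h_smul, h_smul, h_smul, h3, h4, A.h_xi, hP, hQ]
    simp

lemma IsAlmostCosymplectic.mem_U_iff (hA : A.IsAlmostCosymplectic α) :
    p ∈ A.U ↔ 0 < A.lam p := by
  rw [(show 0 ≤ A.lam p from Real.sqrt_nonneg _).lt_iff_ne', ne_eq, ← hA.h_eq_zero_iff]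
  simp [U]

lemma IsAlmostCosymplectic.mem_U'_iff (hA : A.IsAlmostCosymplectic α) :
    p ∈ A.U' ↔ A.lam =ᶠ[𝓝 p] fun _ => 0 := by
  rw [U', mem_interior_iff_mem_nhds]
  refine Filter.eventually_congr (Filter.Eventually.of_forall fun q => hA.h_eq_zero_iff)

lemma IsAdapted.lamSq_eq (he : A.IsAdapted e p) (hA : A.IsAlmostCosymplectic α) :
    A.lamSq p = (metric (nabla e A.xi) (A.phiF e) p) ^ 2 + (metric (nabla e A.xi) e p - α) ^ 2 := by
  rw [← neg_sq (metric (nabla e A.xi) (A.phiF e) p)]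
  refine AlmostContactMetric.lamSq_eq he.unit.self_of_nhds he.eta.self_of_nhds (he.h_self hA) ?_
  rw [neg_smul, sub_neg_eq_add]
  exact he.h_phiF hA

lemma IsAlmostCosymplectic.smooth_lamSq (hA : A.IsAlmostCosymplectic α) (p : M) :
    SmoothFunNear 3 A.lamSq p := by
  obtain ⟨u, h1, h2⟩ := A.exists_unit_eta_eq_zero p
  obtain ⟨e, he, -⟩ := exists_isAdapted h1 h2
  have hB := he.smooth.nabla (A.smooth_xi_near p)
  have h3 := SmoothFunNear.metric hB he.phiF.smooth
  have h4 := (SmoothFunNear.metric hB he.smooth).sub (.const α)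
  refine ((h3.mul h3).add (h4.mul h4)).congr ?_
  filter_upwards [he.eventually] with q hq
  rw [hq.lamSq_eq hA, sq, sq]
  rfl

lemma IsAlmostCosymplectic.smooth_lam (hA : A.IsAlmostCosymplectic α) (hp : p ∈ A.U ∪ A.U') :
    SmoothFunNear 3 A.lam p := by
  rcases hp with hp | hp
  · refine (hA.smooth_lamSq p).sqrt ?_
    rw [← hA.lam_sq]
    exact (pow_pos (hA.mem_U_iff.1 hp) 2).ne'
  · exact (SmoothFunNear.const 0).congr (hA.mem_U'_iff.1 hp)

lemma IsAlmostCosymplectic.isOpen_U (hA : A.IsAlmostCosymplectic α) : IsOpen A.U := by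
  have h1 : Continuous A.lam := Real.continuous_sqrt.comp
    (continuous_iff_continuousAt.2 fun p => (hA.smooth_lamSq p).mdiff.continuousAt)
  have h2 : A.U = {p | 0 < A.lam p} := by
    ext p; exact hA.mem_U_iff
  rw [h2]
  exact isOpen_lt continuous_const h1

/-- The complement of `U` is the set `h = 0`, whose interior is `U'`. -/
lemma dense_U_union_U' : Dense (A.U ∪ A.U') := by
  have h : {p | ∀ u : TangentSpace (𝓡 3) p, A.h u = 0} = A.Uᶜ := by
    ext p; simp [U]
  rw [U', h, interior_compl]
  intro p
  by_cases hp : p ∈ closure A.U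
  · exact closure_mono Set.subset_union_left hp
  · exact subset_closure (Or.inr hp)

variable (A) in
/-- An adapted frame that diagonalises `h` around `p`. -/
structure IsEigenframe (e : VField 3 M) (p : M) : Prop extends A.IsAdapted e p where
  h_self : ∀ᶠ q in 𝓝 p, A.h (e q) = A.lam q • e q
  h_phi : ∀ᶠ q in 𝓝 p, A.h (A.phi q (e q)) = -(A.lam q • A.phi q (e q))

lemma IsEigenframe.eventually (he : A.IsEigenframe e p) : ∀ᶠ q in 𝓝 p, A.IsEigenframe e q := by
  filter_upwards [he.toIsAdapted.eventually, eventually_eventually_nhds.2 he.h_self,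
    eventually_eventually_nhds.2 he.h_phi] with q h1 h2 h3 using ⟨h1, h2, h3⟩

/-- If `P ≥ 0` at `p`, where `h e = P e + Q φ e`, then `(P + λ) e + Q φ e` is a nonvanishing
`λ`-eigenvector field of `h`. -/
lemma IsAdapted.exists_isEigenframe_of_nonneg (hf : A.IsAdapted e p)
    (hA : A.IsAlmostCosymplectic α) (hp : p ∈ A.U)
    (h0 : 0 ≤ -(metric (nabla e A.xi) (A.phiF e) p)) : ∃ e', A.IsEigenframe e' p := by
  have hB := hf.smooth.nabla (A.smooth_xi_near p)
  let P : M → ℝ := -(metric (nabla e A.xi) (A.phiF e))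
  let Q : M → ℝ := metric (nabla e A.xi) e - fun _ => α
  have hP : SmoothFunNear 3 P p := (SmoothFunNear.metric hB hf.phiF.smooth).neg
  have hQ : SmoothFunNear 3 Q p := (SmoothFunNear.metric hB hf.smooth).sub (.const α)
  have hl := hA.smooth_lam (Or.inl hp)
  let Y : VField 3 M := (P + A.lam) • e + Q • A.phiF e
  have hY : SmoothFieldNear Y p := .add (.smul (hP.add hl) hf.smooth) (.smul hQ hf.phiF.smooth)
  have hη : ∀ᶠ q in 𝓝 p, A.eta q (Y q) = 0 := by
    filter_upwards [hf.eta] with q hq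
    simp [Y, hq, AlmostContactMetric.phiF, A.eta_phi]
  have hYY : metric Y Y p ≠ 0 := by
    have h1 : metric Y Y p = (P p + A.lam p) ^ 2 + Q p ^ 2 := by
      have e1 : metric e e p = 1 := hf.unit.self_of_nhds
      have e2 : metric (A.phiF e) (A.phiF e) p = 1 := hf.phiF.unit.self_of_nhds
      have e3 : metric e (A.phiF e) p = 0 := A.inner_self_phi _
      have e4 : metric (A.phiF e) e p = 0 := by rw [metric_comm, e3]
      simp only [Y, metric_add_left, metric_add_right, metric_smul_left, metric_smul_right,
        Pi.add_apply, Pi.mul_apply, e1, e2, e3, e4]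
      ring
    have h2 : 0 < A.lam p := hA.mem_U_iff.1 hp
    have h3 : 0 ≤ P p := h0
    rw [h1]
    positivity
  have hYh : ∀ᶠ q in 𝓝 p, A.h (Y q) = A.lam q • Y q ∧
      A.h (A.phi q (Y q)) = -(A.lam q • A.phi q (Y q)) := by
    filter_upwards [hf.eventually] with q hq
    have e1 : A.h (e q) = P q • e q + Q q • A.phiF e q := hq.h_self hA
    have e2 : A.h (A.phiF e q) = Q q • e q - P q • A.phiF e q := by
      rw [hq.h_phiF hA]
      simp only [P, Q, Pi.neg_apply, Pi.sub_apply, neg_smul, sub_neg_eq_add]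
    have e3 : A.lam q ^ 2 = P q ^ 2 + Q q ^ 2 := by
      rw [hA.lam_sq, hq.lamSq_eq hA]
      simp [P, Q]
    have e4 : Y q = (P q + A.lam q) • e q + Q q • A.phiF e q := rfl
    have e5 : A.phi q (Y q) = (P q + A.lam q) • A.phiF e q - Q q • e q := by
      have h2 : A.phi q (A.phiF e q) = - e q := hq.phiF_phiF.self_of_nhds
      rw [e4, map_add, map_smul, map_smul, h2, smul_neg, ← sub_eq_add_neg]
      rfl
    constructor
    · rw [e4, h_add, h_smul, h_smul, e1, e2]
      match_scalars <;> first | ring1 | linear_combination -e3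
    · rw [e5, sub_eq_add_neg, ← neg_smul, h_add, h_smul, h_smul, e1, e2]
      match_scalars <;> first | ring1 | linear_combination e3
  refine ⟨_, isAdapted_normalize hY hη hYY, ?_, ?_⟩
  · filter_upwards [hYh] with q hq
    rw [Pi.smul_apply', h_smul, hq.1, smul_comm]
  · filter_upwards [hYh] with q hq
    rw [Pi.smul_apply', map_smul, h_smul, hq.2, smul_neg, smul_comm]

/-- On `U` an adapted frame is rotated into an eigenframe; on `U'` every adapted frame is one, as
`h = 0` and `λ = 0` there. -/
lemma IsAlmostCosymplectic.exists_isEigenframe (hA : A.IsAlmostCosymplectic α)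
    (hp : p ∈ A.U ∪ A.U') : ∃ e, A.IsEigenframe e p := by
  obtain ⟨u, h1, h2⟩ := A.exists_unit_eta_eq_zero p
  obtain ⟨f, hf, -⟩ := exists_isAdapted h1 h2
  rcases hp with hp | hp
  · rcases le_total 0 (-(metric (nabla f A.xi) (A.phiF f) p)) with h | h
    · exact hf.exists_isEigenframe_of_nonneg hA hp h
    · -- passing from `f` to `φ f` changes the sign of the diagonal coefficient of `h`
      refine hf.phiF.exists_isEigenframe_of_nonneg hA hp ?_
      have h3 : metric (nabla (A.phiF f) A.xi) (A.phiF (A.phiF f)) p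
          = - metric (nabla f A.xi) (A.phiF f) p := by
        rw [metric, hf.phiF_phiF.self_of_nhds, Pi.neg_apply, inner_neg_right,
          hA.inner_nabla_xi_comm hf.phiF.smooth hf.smooth]
        rfl
      rw [h3]
      linarith
  · have h3 : ∀ᶠ q in 𝓝 p, A.lam q = 0 := hA.mem_U'_iff.1 hp
    refine ⟨f, hf, ?_, ?_⟩ <;>
    · filter_upwards [h3] with q hq
      rw [hA.h_eq_zero_iff.2 hq, hq]
      simp

end Eigenframes

end AlmostContactMetric

/-! ### The Jacobi operator and the functions `μ` and `ν` -/

namespace AlmostContactMetric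

section Jacobi

variable {M : Type*} [TopologicalSpace M]
  [ChartedSpace (EuclideanSpace ℝ (Fin 3)) M] [IsManifold (𝓡 3) ∞ M]
  [RiemannianBundle (fun p : M => TangentSpace (𝓡 3) p)]
  [IsContMDiffRiemannianBundle (𝓡 3) ∞ (EuclideanSpace ℝ (Fin 3))
      (fun p : M => TangentSpace (𝓡 3) p)]
  {A : AlmostContactMetric 3 M} {X Y Z e : VField 3 M} {f : M → ℝ} {p : M} {α : ℝ}
  {u v : TangentSpace (𝓡 3) p}

section Eigenframe

variable (he : A.IsEigenframe e p) (hA : A.IsAlmostCosymplectic α)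
include he

lemma IsEigenframe.inner_phi_self : inner ℝ (A.phiF e p) (e p) = (0 : ℝ) := by
  rw [real_inner_comm]; exact A.inner_self_phi _

lemma IsEigenframe.inner_phi_phi : inner ℝ (A.phiF e p) (A.phiF e p) = (1 : ℝ) :=
  he.phiF.unit.self_of_nhds

include hA

lemma IsEigenframe.nabla_self_xi :
    nabla e A.xi p = α • e p - A.lam p • A.phiF e p := by
  have h := he.toIsAdapted.h_self hA
  rw [he.h_self.self_of_nhds] at h
  have e1 : inner ℝ (e p) (e p) = (1 : ℝ) := he.unit.self_of_nhds
  have e2 : inner ℝ (e p) (A.phiF e p) = (0 : ℝ) := A.inner_self_phi _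
  have h1 := congrArg (inner ℝ (e p)) h
  have h2 := congrArg (inner ℝ (A.phiF e p)) h
  simp only [inner_add_right, real_inner_smul_right, e1, e2, he.inner_phi_self,
    he.inner_phi_phi] at h1 h2
  rw [he.toIsAdapted.nabla_self_xi,
    show metric (nabla e A.xi) (A.phiF e) p = - A.lam p by linarith,
    show metric (nabla e A.xi) e p = α by linarith]
  module

lemma IsEigenframe.nabla_phiF_xi :
    nabla (A.phiF e) A.xi p = α • A.phiF e p - A.lam p • e p := by
  have h := he.nabla_self_xi hA
  have e1 : inner ℝ (e p) (e p) = (1 : ℝ) := he.unit.self_of_nhds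
  have e2 : inner ℝ (e p) (A.phiF e p) = (0 : ℝ) := A.inner_self_phi _
  have h1 : metric (nabla e A.xi) (A.phiF e) p = - A.lam p := by
    rw [metric, h]
    simp only [inner_sub_left, real_inner_smul_left, e2, he.inner_phi_phi]
    ring
  have h2 : metric (nabla e A.xi) e p = α := by
    rw [metric, h]
    simp only [inner_sub_left, real_inner_smul_left, e1, he.inner_phi_self]
    ring
  have h3 := he.div_xi hA
  rw [he.toIsAdapted.nabla_phiF_xi hA, h1,
    show metric (nabla (A.phiF e) A.xi) (A.phiF e) p = α by linarith]
  module

/-- The Jacobi operator in an eigenframe, from `∇_e ξ = α e - λ φ e`, `∇_{φ e} ξ = α φ e - λ e` and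
`∇_ξ φ e = a e`. -/
lemma IsEigenframe.curvature_self_xi (hl : SmoothFunNear 3 A.lam p) :
    curvature (e p) (A.xi p) (A.xi p) =
      (2 * A.lam p * metric e (nabla A.xi (A.phiF e)) p - A.lam p ^ 2 - α ^ 2) • e p
        + (dirDeriv A.xi A.lam p + 2 * α * A.lam p) • A.phiF e p := by
  have hξ := A.smooth_xi_near p
  have hs := he.smooth
  have hφ := he.phiF.smooth
  have h0 : nabla A.xi A.xi = 0 := by ext1 q; exact hA.nabla_xi_xi q
  have h1 : nabla e A.xi =ᶠ[𝓝 p] (fun _ => α : M → ℝ) • e + (-A.lam) • A.phiF e := by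
    filter_upwards [he.eventually] with q hq
    rw [hq.nabla_self_xi hA]
    change _ = α • e q + (-A.lam q) • A.phiF e q
    module
  -- the bracket may be replaced by a combination of the frame with constant coefficients
  have h2 : bracket e A.xi p = ((fun _ => α : M → ℝ) • e
      + (fun _ => metric e (nabla A.xi (A.phiF e)) p - A.lam p : M → ℝ) • A.phiF e) p := by
    rw [← nabla_sub_nabla_swap hs hξ, he.nabla_self_xi hA, he.nabla_xi_self hA]
    simp only [Pi.add_apply, Pi.smul_apply']
    module
  have h3 : nabla e (0 : VField 3 M) p = 0 := by
    have := nabla_smul_right hs (.const 0) hs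
    simpa [show (fun _ => 0 : M → ℝ) • e = 0 by ext1 q; simp] using this
  rw [curvature_eq hs hξ hξ, curvatureField_apply, h0, h3, nabla_congr (.refl _ A.xi) h1,
    nabla_congr_left (.bracket hs hξ) (.add (.smul (.const _) hs) (.smul (.const _) hφ)) hξ h2,
    nabla_add_right hξ (.smul (.const _) hs) (.smul hl.neg hφ),
    nabla_add_left (.smul (.const _) hs) (.smul (.const _) hφ) hξ,
    nabla_smul_right hξ (.const _) hs, nabla_smul_right hξ hl.neg hφ,
    nabla_smul_left (.const _) hs hξ, nabla_smul_left (.const _) hφ hξ,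
    he.nabla_self_xi hA, he.nabla_phiF_xi hA, he.nabla_xi_self hA, he.nabla_xi_phiF hA,
    dirDeriv_neg, dirDeriv_const, Pi.neg_apply]
  module

lemma IsEigenframe.curvature_phiF_xi (hl : SmoothFunNear 3 A.lam p) :
    curvature (A.phiF e p) (A.xi p) (A.xi p) =
      (dirDeriv A.xi A.lam p + 2 * α * A.lam p) • e p
        + (-(2 * A.lam p * metric e (nabla A.xi (A.phiF e)) p) - A.lam p ^ 2 - α ^ 2) •
          A.phiF e p := by
  have hξ := A.smooth_xi_near p
  have hs := he.smooth
  have hφ := he.phiF.smooth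
  have h0 : nabla A.xi A.xi = 0 := by ext1 q; exact hA.nabla_xi_xi q
  have h1 : nabla (A.phiF e) A.xi =ᶠ[𝓝 p] (fun _ => α : M → ℝ) • A.phiF e + (-A.lam) • e := by
    filter_upwards [he.eventually] with q hq
    rw [hq.nabla_phiF_xi hA]
    change _ = α • A.phiF e q + (-A.lam q) • e q
    module
  have h2 : bracket (A.phiF e) A.xi p = ((fun _ => α : M → ℝ) • A.phiF e
      + (fun _ => -(metric e (nabla A.xi (A.phiF e)) p + A.lam p) : M → ℝ) • e) p := by
    rw [← nabla_sub_nabla_swap hφ hξ, he.nabla_phiF_xi hA, he.nabla_xi_phiF hA]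
    simp only [Pi.add_apply, Pi.smul_apply']
    module
  have h3 : nabla (A.phiF e) (0 : VField 3 M) p = 0 := by
    have := nabla_smul_right hφ (.const 0) hs
    simpa [show (fun _ => 0 : M → ℝ) • e = 0 by ext1 q; simp] using this
  rw [curvature_eq hφ hξ hξ, curvatureField_apply, h0, h3, nabla_congr (.refl _ A.xi) h1,
    nabla_congr_left (.bracket hφ hξ) (.add (.smul (.const _) hφ) (.smul (.const _) hs)) hξ h2,
    nabla_add_right hξ (.smul (.const _) hφ) (.smul hl.neg hs),
    nabla_add_left (.smul (.const _) hφ) (.smul (.const _) hs) hξ,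
    nabla_smul_right hξ (.const _) hφ, nabla_smul_right hξ hl.neg hs,
    nabla_smul_left (.const _) hφ hξ, nabla_smul_left (.const _) hs hξ,
    he.nabla_self_xi hA, he.nabla_phiF_xi hA, he.nabla_xi_self hA, he.nabla_xi_phiF hA,
    dirDeriv_neg, dirDeriv_const, Pi.neg_apply]
  module

end Eigenframe

/-- In dimension 3 the vector `R(u, φ u) ξ` is the Ricci form `S(ξ, ·)` on `ker η`, up to a
rotation: by pair symmetry its components along `u` and `φ u` are `S(ξ, φ u)` and `-S(ξ, u)`. -/
lemma SigmaVanishes.curvature_phi (hσ : A.SigmaVanishes) (h1 : inner ℝ u u = (1 : ℝ))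
    (h2 : A.eta p u = 0) : curvature u (A.phi p u) (A.xi p) = 0 := by
  have hr : ∀ w : TangentSpace (𝓡 3) p, ricci (A.xi p) w = inner ℝ (curvature u (A.xi p) w) u
      + inner ℝ (curvature (A.phi p u) (A.xi p) w) (A.phi p u) := by
    intro w
    rw [ricci_eq_sum _ _ (A.orthonormal_phi_basis h1 h2), Fin.sum_univ_three]
    change _ + _ + inner ℝ (curvature (A.xi p) (A.xi p) w) (A.xi p) = _
    rw [curvature_self, inner_zero_left, add_zero]
    rfl
  have hs : ∀ a b c : TangentSpace (𝓡 3) p, inner ℝ (curvature a b c) c = (0 : ℝ) := by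
    intro a b c
    linarith [inner_curvature_swap a b c c]
  have s1 := hσ p u h2
  have s2 := hσ p (A.phi p u) (A.eta_phi u)
  rw [hr, hs, zero_add, inner_curvature_pair_swap, inner_curvature_swap] at s1
  rw [hr, hs, add_zero, inner_curvature_pair_swap, curvature_swap, inner_neg_left,
    inner_curvature_swap] at s2
  have e1 : inner ℝ u (curvature u (A.phi p u) (A.xi p)) = (0 : ℝ) := by
    rw [real_inner_comm]; linarith
  have e2 : inner ℝ (A.phi p u) (curvature u (A.phi p u) (A.xi p)) = (0 : ℝ) := by
    rw [real_inner_comm]; linarith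
  have e3 : A.eta p (curvature u (A.phi p u) (A.xi p)) = 0 := by
    rw [A.eta_eq_inner, real_inner_comm, hs]
  rw [A.phi_basis_expansion h1 h2 (curvature u (A.phi p u) (A.xi p)), e1, e2, e3]
  simp

variable (A) in
/-- The function `tr(l h) / (2 λ²)`. It equals `2 g(e, ∇_ξ φ e)` where `h ≠ 0`, and this expression
for it does not involve a choice of frame; where `λ = 0` its value is `0`. -/
def mu (p : M) : ℝ :=
  (∑ i, inner ℝ (curvature (A.h (onb p i)) (A.xi p) (A.xi p)) (onb p i)) / (2 * A.lam p ^ 2)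

variable (A) in
/-- The function `2α + ξ(λ)/λ`; where `λ = 0` the division makes its value `2α`. -/
def nu (α : ℝ) (p : M) : ℝ := 2 * α + dirDeriv A.xi A.lam p / A.lam p

lemma IsEigenframe.mu_eq (he : A.IsEigenframe e p) (hA : A.IsAlmostCosymplectic α)
    (hp : p ∈ A.U) : A.mu p = 2 * metric e (nabla A.xi (A.phiF e)) p := by
  have h1 : inner ℝ (e p) (e p) = (1 : ℝ) := he.unit.self_of_nhds
  have h2 := A.sum_inner_onb_phi ((curvatureMap (A.xi p) (A.xi p)).comp (A.hMap p)) h1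
    he.eta.self_of_nhds
  have hl := hA.smooth_lam (Or.inl hp)
  have h3 : A.h (A.phiF e p) = (- A.lam p) • A.phiF e p := by
    rw [neg_smul]; exact he.h_phi.self_of_nhds
  have e2 : inner ℝ (e p) (A.phiF e p) = (0 : ℝ) := A.inner_self_phi _
  change ∑ i, inner ℝ (curvature (A.h (onb p i)) (A.xi p) (A.xi p)) (onb p i)
    = inner ℝ (curvature (A.h (e p)) (A.xi p) (A.xi p)) (e p)
    + inner ℝ (curvature (A.h (A.phiF e p)) (A.xi p) (A.xi p)) (A.phiF e p)
    + inner ℝ (curvature (A.h (A.xi p)) (A.xi p) (A.xi p)) (A.xi p) at h2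
  rw [h3, he.h_self.self_of_nhds, A.h_xi, curvature_smul_left, curvature_smul_left,
    he.curvature_self_xi hA hl, he.curvature_phiF_xi hA hl,
    show curvature (0 : TangentSpace (𝓡 3) p) (A.xi p) (A.xi p) = 0 from
      map_zero (curvatureMap (A.xi p) (A.xi p))] at h2
  simp only [inner_add_left, real_inner_smul_left, h1, e2, he.inner_phi_self, he.inner_phi_phi,
    inner_zero_left] at h2
  have h4 : A.lam p ≠ 0 := (hA.mem_U_iff.1 hp).ne'
  rw [mu, h2]
  field_simp
  ring

lemma IsEigenframe.traceJacobi_eq (he : A.IsEigenframe e p) (hA : A.IsAlmostCosymplectic α)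
    (hl : SmoothFunNear 3 A.lam p) : A.traceJacobi p = -2 * (α ^ 2 + A.lam p ^ 2) := by
  have h1 : inner ℝ (e p) (e p) = (1 : ℝ) := he.unit.self_of_nhds
  have h2 := A.sum_inner_onb_phi (curvatureMap (A.xi p) (A.xi p)) h1 he.eta.self_of_nhds
  have e2 : inner ℝ (e p) (A.phiF e p) = (0 : ℝ) := A.inner_self_phi _
  change A.traceJacobi p = inner ℝ (curvature (e p) (A.xi p) (A.xi p)) (e p)
    + inner ℝ (curvature (A.phiF e p) (A.xi p) (A.xi p)) (A.phiF e p)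
    + inner ℝ (curvature (A.xi p) (A.xi p) (A.xi p)) (A.xi p) at h2
  rw [h2, he.curvature_self_xi hA hl, he.curvature_phiF_xi hA hl, curvature_self]
  simp only [inner_add_left, real_inner_smul_left, h1, e2, he.inner_phi_self, he.inner_phi_phi,
    inner_zero_left]
  ring

lemma IsAlmostCosymplectic.mu_eq_zero (hA : A.IsAlmostCosymplectic α) (hp : p ∈ A.U') :
    A.mu p = 0 := by
  have := (hA.mem_U'_iff.1 hp).self_of_nhds
  rw [mu, this]
  simp

lemma IsAlmostCosymplectic.smooth_mu (hA : A.IsAlmostCosymplectic α) (hp : p ∈ A.U ∪ A.U') :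
    SmoothFunNear 3 A.mu p := by
  obtain ⟨e, he⟩ := hA.exists_isEigenframe hp
  rcases hp with hp | hp
  · refine (SmoothFunNear.mul (.const 2) (.metric he.smooth
      (.nabla (A.smooth_xi_near p) he.phiF.smooth))).congr ?_
    filter_upwards [he.eventually, hA.isOpen_U.mem_nhds hp] with q h1 h2 using h1.mu_eq hA h2
  · refine (SmoothFunNear.const 0).congr ?_
    filter_upwards [isOpen_interior.mem_nhds hp] with q hq using hA.mu_eq_zero hq

lemma IsAlmostCosymplectic.smooth_nu (hA : A.IsAlmostCosymplectic α) (hp : p ∈ A.U ∪ A.U') :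
    SmoothFunNear 3 (A.nu α) p := by
  have hl := hA.smooth_lam hp
  rcases hp with hp | hp
  · exact (SmoothFunNear.const (2 * α)).add (.mul (.dirDeriv (A.smooth_xi_near p) hl)
      (.inv hl (hA.mem_U_iff.1 hp).ne'))
  · refine (SmoothFunNear.const (2 * α)).congr ?_
    filter_upwards [hA.mem_U'_iff.1 hp] with q hq
    simp [nu, hq]

/-- The `(κ, μ, ν)`-condition at a point of `U ∪ U'`. Both sides are skew in `u` and `v`, so they are
compared on the pairs of vectors of an eigenframe. -/
lemma curvature_xi_eq (hA : A.IsAlmostCosymplectic α) (hσ : A.SigmaVanishes)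
    (hp : p ∈ A.U ∪ A.U') :
    curvature u v (A.xi p) =
      A.eta p v • (-(α ^ 2 + A.lam p ^ 2) • u + A.mu p • A.h u + A.nu α p • A.phi p (A.h u))
        - A.eta p u •
          (-(α ^ 2 + A.lam p ^ 2) • v + A.mu p • A.h v + A.nu α p • A.phi p (A.h v)) := by
  obtain ⟨e, he⟩ := hA.exists_isEigenframe hp
  have hl := hA.smooth_lam hp
  have hμ : A.mu p * A.lam p = 2 * A.lam p * metric e (nabla A.xi (A.phiF e)) p := by
    rcases hp with hp | hp
    · rw [he.mu_eq hA hp]; ring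
    · rw [hA.mu_eq_zero hp, show A.lam p = 0 from (hA.mem_U'_iff.1 hp).self_of_nhds]; ring
  have hν : A.nu α p * A.lam p = dirDeriv A.xi A.lam p + 2 * α * A.lam p := by
    rcases hp with hp | hp
    · have := (hA.mem_U_iff.1 hp).ne'
      rw [nu]
      field_simp
      ring
    · have h1 := hA.mem_U'_iff.1 hp
      rw [dirDeriv_congr h1, show A.lam p = 0 from h1.self_of_nhds, dirDeriv_const]; ring
  have h1 : inner ℝ (e p) (e p) = (1 : ℝ) := he.unit.self_of_nhds
  have h2 : A.eta p (e p) = 0 := he.eta.self_of_nhds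
  -- on `U'` the values of `μ` and `ν` do not matter, as `h = 0`; `hμ` and `hν` cover both cases
  have c1 : curvature (e p) (A.phiF e p) (A.xi p) = 0 := hσ.curvature_phi h1 h2
  have c2 := he.curvature_self_xi hA hl
  have c3 := he.curvature_phiF_xi hA hl
  rw [← hμ, ← hν] at c2 c3
  have h3 : A.h (A.phiF e p) = (- A.lam p) • A.phiF e p := by
    rw [neg_smul]; exact he.h_phi.self_of_nhds
  have h4 := he.h_self.self_of_nhds
  have h5 : A.phi p (A.phiF e p) = - e p := he.phiF_phiF.self_of_nhds
  have h6 : A.phi p (e p) = A.phiF e p := rfl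
  obtain ⟨u₁, u₂, u₃, rfl⟩ : ∃ a b c : ℝ, u = a • e p + b • A.phiF e p + c • A.xi p :=
    ⟨_, _, _, he.expansion u⟩
  obtain ⟨v₁, v₂, v₃, rfl⟩ : ∃ a b c : ℝ, v = a • e p + b • A.phiF e p + c • A.xi p :=
    ⟨_, _, _, he.expansion v⟩
  have h7 : A.eta p (A.phiF e p) = 0 := A.eta_phi _
  simp only [curvature_add_left, curvature_add_middle, curvature_smul_left, curvature_smul_middle,
    curvature_self, curvature_swap (A.phiF e p) (e p), curvature_swap (A.xi p), c1, c2, c3,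
    h_add, h_smul, h3, h4, A.h_xi, map_add, map_smul, map_zero, h2, h5, h6, h7, A.eta_xi]
  simp only [smul_eq_mul]
  match_scalars <;> ring

end Jacobi

end AlmostContactMetric

/-! ### From germs at a point to open sets -/

lemma SmoothFunNear.contMDiffOn {n : ℕ} {M : Type*} [TopologicalSpace M]
    [ChartedSpace (EuclideanSpace ℝ (Fin n)) M] {f : M → ℝ} {W : Set M}
    (hf : ∀ p ∈ W, SmoothFunNear n f p) : ContMDiffOn (𝓡 n) 𝓘(ℝ, ℝ) ∞ f W :=
  fun p hp => (hf p hp).self_of_nhds.contMDiffWithinAt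

namespace AlmostContactMetric

section

variable {M : Type*} [TopologicalSpace M]
  [ChartedSpace (EuclideanSpace ℝ (Fin 3)) M] [IsManifold (𝓡 3) ∞ M]
  [RiemannianBundle (fun p : M => TangentSpace (𝓡 3) p)]
  [IsContMDiffRiemannianBundle (𝓡 3) ∞ (EuclideanSpace ℝ (Fin 3))
      (fun p : M => TangentSpace (𝓡 3) p)]
  {A : AlmostContactMetric 3 M} {e : VField 3 M} {p : M} {W : Set M}

lemma IsPhiBasis.isEigenframe (hW : IsOpen W) (h : A.IsPhiBasis A.lam W e) (hp : p ∈ W) :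
    A.IsEigenframe e p where
  smooth := by
    filter_upwards [hW.mem_nhds hp] with q hq using (h.1 q hq).contMDiffAt (hW.mem_nhds hq)
  unit := by filter_upwards [hW.mem_nhds hp] with q hq using (h.2 q hq).1
  eta := by filter_upwards [hW.mem_nhds hp] with q hq using (h.2 q hq).2.1
  h_self := by filter_upwards [hW.mem_nhds hp] with q hq using (h.2 q hq).2.2.1
  h_phi := by filter_upwards [hW.mem_nhds hp] with q hq using (h.2 q hq).2.2.2

lemma IsEigenframe.exists_isPhiBasis (he : A.IsEigenframe e p) (hW : W ∈ 𝓝 p) :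
    ∃ V ⊆ W, IsOpen V ∧ p ∈ V ∧ A.IsPhiBasis A.lam V e := by
  obtain ⟨V, hV, hVo, hpV⟩ := mem_nhds_iff.1 (Filter.inter_mem hW he.eventually)
  refine ⟨V, fun q hq => (hV hq).1, hVo, hpV, fun q hq => ?_, fun q hq => ?_⟩
  · exact (hV hq).2.smooth.smoothAt.contMDiffWithinAt
  · have h := (hV hq).2
    exact ⟨h.unit.self_of_nhds, h.eta.self_of_nhds, h.h_self.self_of_nhds, h.h_phi.self_of_nhds⟩

end
end AlmostContactMetric

end AlmostCosymplectic

end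

theorem mainTheorem10 {M : Type*} [TopologicalSpace M] [T2Space M] [SecondCountableTopology M]
    [ChartedSpace (EuclideanSpace ℝ (Fin 3)) M] [IsManifold (𝓡 3) ∞ M]
    [RiemannianBundle (fun p : M => TangentSpace (𝓡 3) p)]
    [IsContMDiffRiemannianBundle (𝓡 3) ∞ (EuclideanSpace ℝ (Fin 3))
      (fun p : M => TangentSpace (𝓡 3) p)]
    (A : AlmostCosymplectic.AlmostContactMetric 3 M) (α : ℝ)
    (hA : A.IsAlmostCosymplectic α) (hσ : A.SigmaVanishes) :
    IsOpen (A.U ∪ A.U') ∧ Dense (A.U ∪ A.U') ∧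
    ∃ lam κ μ ν : M → ℝ,
      -- `lam` is the positive eigenvalue of `h` on `U` and vanishes on `U'`
      ContMDiffOn (𝓡 3) 𝓘(ℝ, ℝ) ∞ lam (A.U ∪ A.U') ∧
      (∀ p ∈ A.U, 0 < lam p) ∧ (∀ p ∈ A.U', lam p = 0) ∧
      (∀ p ∈ A.U, ∃ (W : Set M) (e : AlmostCosymplectic.VField 3 M),
        IsOpen W ∧ p ∈ W ∧ W ⊆ A.U ∧ A.IsPhiBasis lam W e) ∧
      -- the structure and its parameters
      A.IsKappaMuNuOn (A.U ∪ A.U') κ μ ν ∧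
      (∀ p ∈ A.U ∪ A.U', κ p = A.traceJacobi p / 2 ∧
        A.traceJacobi p / 2 = -(α ^ 2 + lam p ^ 2)) ∧
      (∀ (W : Set M) (e : AlmostCosymplectic.VField 3 M),
        IsOpen W → W ⊆ A.U → A.IsPhiBasis lam W e →
        ∀ p ∈ W,
          μ p = 2 * AlmostCosymplectic.metric e
            (AlmostCosymplectic.nabla A.xi (A.phiF e)) p) ∧
      (∀ p ∈ A.U, ν p = 2 * α + AlmostCosymplectic.dirDeriv A.xi lam p / lam p) := by
  open AlmostCosymplectic in
  refine ⟨hA.isOpen_U.union isOpen_interior, AlmostContactMetric.dense_U_union_U', A.lam,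
    fun p => -(α ^ 2 + A.lam p ^ 2), A.mu, A.nu α, ?_, ?_, ?_, ?_, ⟨?_, ?_, ?_, ?_⟩, ?_, ?_, ?_⟩
  · exact SmoothFunNear.contMDiffOn fun p hp => hA.smooth_lam hp
  · exact fun p hp => hA.mem_U_iff.1 hp
  · exact fun p hp => (hA.mem_U'_iff.1 hp).self_of_nhds
  · intro p hp
    obtain ⟨e, he⟩ := hA.exists_isEigenframe (Or.inl hp)
    obtain ⟨V, h1, h2, h3, h4⟩ := he.exists_isPhiBasis (hA.isOpen_U.mem_nhds hp)
    exact ⟨V, e, h2, h3, h1, h4⟩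
  · refine SmoothFunNear.contMDiffOn fun p hp => ?_
    have hl := hA.smooth_lam hp
    refine ((SmoothFunNear.const (α ^ 2)).add (hl.mul hl)).neg.congr ?_
    exact Filter.Eventually.of_forall fun q => by simp [sq]
  · exact SmoothFunNear.contMDiffOn fun p hp => hA.smooth_mu hp
  · exact SmoothFunNear.contMDiffOn fun p hp => hA.smooth_nu hp
  · exact fun p hp u v => AlmostContactMetric.curvature_xi_eq hA hσ hp
  · intro p hp
    obtain ⟨e, he⟩ := hA.exists_isEigenframe hp
    have h := he.traceJacobi_eq hA (hA.smooth_lam hp)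
    have h1 : A.traceJacobi p / 2 = -(α ^ 2 + A.lam p ^ 2) := by rw [h]; ring
    exact ⟨h1.symm, h1⟩
  · exact fun W e hW hWU he p hp => (he.isEigenframe hW hp).mu_eq hA (hWU hp)
  · exact fun p _ => rfl
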